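/- **Setting.** Let $d\ge 1$, $s\ge 0$, $0<\mu\le\beta$, $L>0$, $r_f\in(0,1)$, $\varepsilon>0$, $\delta\in(0,1)$, and let $\mathcal D_r,\mathcal D_f$ be probability distributions on $\mathbb R^s$ (retain and forget data), $\mathcal D=r_f\mathcal D_f+(1-r_f)\mathcal D_r$. Put $\rho=\frac{r_f}{1-r_f}$, $\kappa_\ell=\beta/\mu$, $e_0=L^2/\mu$, $\kappa_{\varepsilon,\delta}=\varepsilon^{-1}\sqrt{2\log(2.5/\delta)}$, $h(T,\delta)=1+624(\log\log T+\log(2/\delta))$ and $\nu_T=\sqrt{2h(T,\delta)}\,L\,\frac{1+\kappa_\ell}{\mu\sqrt T}$. For a loss $\ell(\theta,\xi)$ let $\mathcal L(\theta,\mathcal D')=\mathbb E_{\xi\sim\mathcal D'}\ell(\theta,\xi)$, $\mathcal L_r=\mathcal L(\cdot,\mathcal D_r)$, and let $\theta^*,\theta^*_r$ be the minimizers of $\mathcal L(\cdot,\mathcal D)$, $\mathcal L_r$ over $\mathbb R^d$. The class $\mathcal F$ consists of the losses (with their domain $K\subseteq\mathbb R^d$, closed, convex, with non-empty interior) that are measurable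 in $\xi$, such that for every $\xi$ the function $\ell(\cdot,\xi)$ is differentiable, $\mu$-strongly convex and $\beta$-smooth on $\mathbb R^d$ and $L$-Lipschitz on $K$, that have finite risks under $\mathcal D_r$ and $\mathcal D_f$, and whose domain contains $\theta^*$ and $\theta_r^*$. For an unlearning algorithm $\mathcal U$ let $T_e(\ell,\mathcal U)$ be the least number of iterations $T\ge 2$ after which $\mathbb E[\mathcal L_r(\mathcal U(T,\ell,\mathcal D_r,\mathcal D_f))-\mathcal L_r(\theta^*_r)]\le e$ ($\infty$ if there is none), and $T_e(\mathcal U)=\sup_{\ell\in\mathcal F}T_e(\ell,\mathcal U)$. *VRU.* Start at $\theta_0=\theta^*$; for $t=0,\dots,T-1$ draw fresh independent $\xi^r\sim\mathcal D_r$, $\xi^f\sim\mathcal D_f$ and let $\theta_{t+1}$ be the projection onto the closed ball $B(\theta^*,\rho L/\mu)$ of $\theta_t-\frac1{\mu(t+1)}\bigl(\nabla\ell(\theta_t,\xi^r)-\nabla\ell(\theta^*,\xi^r)-\rho\nabla\ell(\theta^*,\xi^f)\bigr)$; return $\theta_T+\rho\,\nu_T\,\kappa_{\varepsilon,\delta}Z$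 with $Z\sim\mathcal N(0,I_d)$ independent. *NFT (Noise-and-Fine-Tune).* Start at $\theta_0=\mathrm{proj}_K(\theta^*+\kappa_{\varepsilon,\delta}\,\rho\frac L\mu Z)$ with $Z\sim\mathcal N(0,I_d)$; for $t=0,\dots,T-1$ draw a fresh independent $\xi\sim\mathcal D_r$ and let $\theta_{t+1}=\mathrm{proj}_K(\theta_t-\eta\nabla\ell(\theta_t,\xi))$ with $\eta=\rho\sqrt{1+d\kappa_{\varepsilon,\delta}^2}\,/(\mu\sqrt T)$; return the average of $\theta_0,\dots,\theta_{T-1}$. For $e>0$ put $$T_e^{\max}(\mathrm{VRU})=\kappa_\ell^3\bigl(1+d\kappa_{\varepsilon,\delta}^2\log\tfrac1\delta\bigr)\frac{e_0}{e}\rho^2,\qquad T_e^{\max}(\mathrm{NFT})=\bigl(1+d\kappa_{\varepsilon,\delta}^2\bigr)\Bigl(\frac{e_0}{e}\Bigr)^2\rho^2 .$$ **Statement.** Let $\varepsilon_0>0$ and $0<\delta_0<1$. There are constants $c,C>0$, depending only on $\varepsilon_0,\delta_0$, such that for all $d,s,\mu,\beta,L,r_f$ as above and all $\varepsilon\le\varepsilon_0$,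 $\delta\le\delta_0$: 1. for all $\mathcal D_r,\mathcal D_f$ and all $e>0$, these expressions are asymptotic upper bounds (the first up to a logarithmic factor) on the worst-case convergence times: $$T_e(\mathrm{VRU})\le C\bigl(1+T_e^{\max}(\mathrm{VRU})\bigr)\log\bigl(3+T_e^{\max}(\mathrm{VRU})\bigr),\qquad T_e(\mathrm{NFT})\le C\bigl(1+T_e^{\max}(\mathrm{NFT})\bigr);$$ 2. for all $e>0$, $$c\,\kappa_\ell^3\log\tfrac1\delta\,\frac e{e_0}\;\le\;\frac{T_e^{\max}(\mathrm{VRU})}{T_e^{\max}(\mathrm{NFT})}\;\le\;C\,\kappa_\ell^3\log\tfrac1\delta\,\frac e{e_0},\qquad\text{i.e. the ratio is }\Theta\Bigl(\kappa_\ell^3\log(1/\delta)\frac e{e_0}\Bigr);$$ 3. with all other parameters fixed, as $e\to0^+$, $T_e^{\max}(\mathrm{VRU})=\Theta(1/e)$, $T_e^{\max}(\mathrm{NFT})=\Theta(1/e^2)$, and the ratio $T_e^{\max}(\mathrm{VRU})/T_e^{\max}(\mathrm{NFT})$ tends to $0$. -/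

import Mathlib

open MeasureTheory ProbabilityTheory Filter Topology Asymptotics
open scoped ENNReal

namespace Unlearning

noncomputable section

/-- Model space `ℝ^d` with the Euclidean norm. -/
abbrev Model (d : ℕ) := EuclideanSpace ℝ (Fin d)

/-- Data space `ℝ^s`. -/
abbrev Data (s : ℕ) := EuclideanSpace ℝ (Fin s)

/-- A sample loss `ℓ(θ, ξ)` together with its domain: the set of models on which the loss is
Lipschitz (a function which is strongly convex cannot be Lipschitz on the whole of `ℝ^d`). -/
structure Loss (d s : ℕ) where
  toFun : Model d → Data s → ℝ
  dom : Set (Model d)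

/-- Scalar parameters: strong convexity `μ`, smoothness `β`, Lipschitz constant `L`,
forget fraction `rf` and privacy levels `ε`, `δ`. -/
structure Params where
  μ : ℝ
  β : ℝ
  L : ℝ
  rf : ℝ
  ε : ℝ
  δ : ℝ

namespace Params

/-- The admissible range of the parameters. -/
structure Valid (P : Params) : Prop where
  μ_pos : 0 < P.μ
  μ_le_β : P.μ ≤ P.β
  L_pos : 0 < P.L
  rf_pos : 0 < P.rf
  rf_lt_one : P.rf < 1
  ε_pos : 0 < P.ε
  δ_pos : 0 < P.δ
  δ_lt_one : P.δ < 1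

/-- `r_f / (1 - r_f)`. -/
def ratio (P : Params) : ℝ := P.rf / (1 - P.rf)

/-- Condition number `κ_ℓ = β / μ`. -/
def condNumber (P : Params) : ℝ := P.β / P.μ

/-- Privacy budget `κ_{ε,δ} = ε⁻¹ √(2 log (2.5 / δ))`. -/
def privacyBudget (P : Params) : ℝ := P.ε⁻¹ * √(2 * Real.log (2.5 / P.δ))

/-- The error scale `e₀ = L² / μ` of the class of losses. -/
def e₀ (P : Params) : ℝ := P.L ^ 2 / P.μ

/-- `h(T, δ) = 1 + 624 (log log T + log (2 / δ))`. -/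
def h (P : Params) (T : ℕ) : ℝ :=
  1 + 624 * (Real.log (Real.log (T : ℝ)) + Real.log (2 / P.δ))

/-- `ν_T = √(2 h(T, δ)) L (1 + κ_ℓ) / (μ √T)`; meaningful for `T ≥ 2`. -/
def ν (P : Params) (T : ℕ) : ℝ :=
  √(2 * P.h T) * P.L * ((1 + P.condNumber) / (P.μ * √(T : ℝ)))

end Params

variable {d s : ℕ}

/-! ### Losses, risks and minimizers -/

/-- Loss regularity: every `ℓ(·, ξ)` is differentiable, `μ`-strongly convex and `β`-smooth on `ℝ^d`,
and `L`-Lipschitz on the domain, a closed convex set with non-empty interior. -/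
structure Loss.IsRegular (ℓ : Loss d s) (μ β L : ℝ) : Prop where
  dom_closed : IsClosed ℓ.dom
  dom_convex : Convex ℝ ℓ.dom
  dom_interior : (interior ℓ.dom).Nonempty
  measurable : ∀ θ, Measurable (ℓ.toFun θ)
  differentiable : ∀ ξ, Differentiable ℝ (fun θ => ℓ.toFun θ ξ)
  strongConvex : ∀ ξ θ θ', ℓ.toFun θ' ξ ≥ ℓ.toFun θ ξ
    + inner ℝ (gradient (fun ϑ => ℓ.toFun ϑ ξ) θ) (θ' - θ) + μ / 2 * ‖θ' - θ‖ ^ 2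
  smooth : ∀ ξ θ θ', ‖gradient (fun ϑ => ℓ.toFun ϑ ξ) θ - gradient (fun ϑ => ℓ.toFun ϑ ξ) θ'‖
    ≤ β * ‖θ - θ'‖
  lipschitz : ∀ ξ, ∀ θ ∈ ℓ.dom, ∀ θ' ∈ ℓ.dom, |ℓ.toFun θ ξ - ℓ.toFun θ' ξ| ≤ L * ‖θ - θ'‖

/-- `∇ℓ(θ, ξ)`, the gradient in the model variable. -/
def Loss.grad (ℓ : Loss d s) (θ : Model d) (ξ : Data s) : Model d :=
  gradient (fun ϑ => ℓ.toFun ϑ ξ) θ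

/-- Population risk `𝓛(θ, D) = 𝔼_{ξ ∼ D} ℓ(θ, ξ)`. -/
def Loss.risk (ℓ : Loss d s) (D : Measure (Data s)) (θ : Model d) : ℝ := ∫ ξ, ℓ.toFun θ ξ ∂D

/-- The minimizer of `𝓛(·, D)` over `ℝ^d` (it is unique for the losses considered). -/
def Loss.opt (ℓ : Loss d s) (D : Measure (Data s)) : Model d :=
  Classical.epsilon fun θ => ∀ θ', ℓ.risk D θ ≤ ℓ.risk D θ'

/-- The training distribution `D = r_f D_f + (1 - r_f) D_r`. -/
def trainDist (rf : ℝ) (Dr Df : Measure (Data s)) : Measure (Data s) :=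
  ENNReal.ofReal rf • Df + ENNReal.ofReal (1 - rf) • Dr

/-- The class `𝓕` for the data distributions `D_r`, `D_f`: regular losses of finite population
risk whose domain contains the original optimum `θ*` and the retain optimum `θ*_r`. -/
def lossClass (P : Params) (d : ℕ) (Dr Df : Measure (Data s)) : Set (Loss d s) :=
  {ℓ | ℓ.IsRegular P.μ P.β P.L ∧
    (∀ θ, Integrable (ℓ.toFun θ) Dr) ∧ (∀ θ, Integrable (ℓ.toFun θ) Df) ∧
    ℓ.opt (trainDist P.rf Dr Df) ∈ ℓ.dom ∧ ℓ.opt Dr ∈ ℓ.dom}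

/-! ### Unlearning algorithms and convergence times -/

/-- A randomized unlearning algorithm: the law of the output model, as a function of the number of
iterations, the loss, the retain distribution and the forget distribution. -/
abbrev Algorithm (d s : ℕ) :=
  ℕ → Loss d s → Measure (Data s) → Measure (Data s) → Measure (Model d)

/-- Expected excess risk on the retain distribution of a random model with law `Q`, as an element
of `[0, ∞]` (the excess risk is non-negative). -/
def expectedExcess (ℓ : Loss d s) (Dr : Measure (Data s)) (Q : Measure (Model d)) : ℝ≥0∞ :=
  ∫⁻ θ, ENNReal.ofReal (ℓ.risk Dr θ - ℓ.risk Dr (ℓ.opt Dr)) ∂Q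

/-- `T_e(ℓ, U)`: the least number of iterations after which the expected excess retain risk is at
most `e` (and `∞` if there is none). Iteration counts start at `2`, because `log log T` in the
noise scale of VRU only makes sense from there on. -/
def convTimeLoss (U : Algorithm d s) (e : ℝ) (ℓ : Loss d s) (Dr Df : Measure (Data s)) : ℝ≥0∞ :=
  ⨅ T ∈ {T : ℕ | 2 ≤ T ∧ expectedExcess ℓ Dr (U T ℓ Dr Df) ≤ ENNReal.ofReal e}, (T : ℝ≥0∞)

/-- Worst-case convergence time `T_e(U) = sup_{ℓ ∈ 𝓕} T_e(ℓ, U)`. -/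
def convTime (P : Params) (U : Algorithm d s) (e : ℝ) (Dr Df : Measure (Data s)) : ℝ≥0∞ :=
  ⨆ ℓ ∈ lossClass P d Dr Df, convTimeLoss U e ℓ Dr Df

/-- Euclidean projection of `x` onto `C` (for `C` closed, convex and non-empty). -/
def proj (C : Set (Model d)) (x : Model d) : Model d :=
  Classical.epsilon fun y => y ∈ C ∧ ∀ z ∈ C, ‖x - y‖ ≤ ‖x - z‖

/-! ### Variance-Reduced Unlearning -/

/-- The variance-reduced stochastic gradient
`∇ℓ(θ, ξ^r) - ∇ℓ(θ*, ξ^r) - r_f / (1 - r_f) ∇ℓ(θ*, ξ^f)`. -/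
def vruGrad (P : Params) (ℓ : Loss d s) (θstar θ : Model d) (ξr ξf : Data s) : Model d :=
  ℓ.grad θ ξr - ℓ.grad θstar ξr - P.ratio • ℓ.grad θstar ξf

/-- The update number `t + 1`: a step of size `1 / (μ (t + 1))`, then projection onto the closed
ball of radius `r_f / (1 - r_f) · L / μ` around `θ*`. -/
def vruStep (P : Params) (ℓ : Loss d s) (θstar : Model d) (t : ℕ) (θ : Model d)
    (ξr ξf : Data s) : Model d :=
  proj (Metric.closedBall θstar (P.ratio * (P.L / P.μ)))
    (θ - (1 / (P.μ * ((t : ℝ) + 1))) • vruGrad P ℓ θstar θ ξr ξf)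

/-- The law of the iterate `θ_t`, started at `θ*`, with fresh independent samples `ξ^r ∼ D_r` and
`ξ^f ∼ D_f` at each update. -/
def vruIterLaw (P : Params) (ℓ : Loss d s) (Dr Df : Measure (Data s)) (θstar : Model d) :
    ℕ → Measure (Model d)
  | 0 => Measure.dirac θstar
  | t + 1 => ((vruIterLaw P ℓ Dr Df θstar t).prod (Dr.prod Df)).map
      fun q => vruStep P ℓ θstar t q.1 q.2.1 q.2.2

/-- VRU: the law of `θ_T + r_f / (1 - r_f) ν_T κ_{ε,δ} Z` with `Z ∼ N(0, I_d)` independent. -/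
def VRU (P : Params) : Algorithm d s := fun T ℓ Dr Df =>
  ((vruIterLaw P ℓ Dr Df (ℓ.opt (trainDist P.rf Dr Df)) T).prod (stdGaussian (Model d))).map
    fun q => q.1 + (P.ratio * P.ν T * P.privacyBudget) • q.2

/-! ### Noise and Fine-Tune -/

/-- Law of the noised start: `θ* + κ_{ε,δ} r_f / (1 - r_f) (L / μ) Z` with `Z ∼ N(0, I_d)`,
projected onto the domain. The noise is the Gaussian mechanism for the bound
`‖θ* - θ*_r‖ ≤ r_f / (1 - r_f) · L / μ`. -/
def nftInitLaw (P : Params) (ℓ : Loss d s) (θstar : Model d) : Measure (Model d) :=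
  (stdGaussian (Model d)).map fun z =>
    proj ℓ.dom (θstar + (P.privacyBudget * P.ratio * (P.L / P.μ)) • z)

/-- Step size of NFT for a run of `T` iterations of dimension `d`:
`r_f / (1 - r_f) √(1 + d κ_{ε,δ}²) / (μ √T)`. -/
def nftStepSize (P : Params) (d T : ℕ) : ℝ :=
  P.ratio * √(1 + d * P.privacyBudget ^ 2) / (P.μ * √(T : ℝ))

/-- Joint law of the iterate `θ_t` of projected stochastic gradient descent on the retain
distribution with step size `η` and of the sum `θ_0 + ⋯ + θ_{t-1}`. -/
def nftIterLaw (P : Params) (ℓ : Loss d s) (Dr : Measure (Data s)) (θstar : Model d) (η : ℝ) :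
    ℕ → Measure (Model d × Model d)
  | 0 => (nftInitLaw P ℓ θstar).map fun θ => (θ, 0)
  | t + 1 => ((nftIterLaw P ℓ Dr θstar η t).prod Dr).map
      fun q => (proj ℓ.dom (q.1.1 - η • ℓ.grad q.1.1 q.2), q.1.2 + q.1.1)

/-- NFT: noise the original optimum, fine-tune by `T` iterations of projected stochastic gradient
descent on the retain distribution, and return the average of the iterates. -/
def NFT (P : Params) : Algorithm d s := fun T ℓ Dr Df =>
  (nftIterLaw P ℓ Dr (ℓ.opt (trainDist P.rf Dr Df)) (nftStepSize P d T) T).map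
    fun q => (T : ℝ)⁻¹ • q.2

/-! ### The asymptotic upper bounds -/

/-- `T_e^max(VRU) = κ_ℓ³ (1 + d κ_{ε,δ}² log (1 / δ)) (e₀ / e) (r_f / (1 - r_f))²`. -/
def TmaxVRU (P : Params) (d : ℕ) (e : ℝ) : ℝ :=
  P.condNumber ^ 3 * (1 + d * P.privacyBudget ^ 2 * Real.log (1 / P.δ)) * (P.e₀ / e) * P.ratio ^ 2

/-- `T_e^max(NFT) = (1 + d κ_{ε,δ}²) (e₀ / e)² (r_f / (1 - r_f))²`. -/
def TmaxNFT (P : Params) (d : ℕ) (e : ℝ) : ℝ :=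
  (1 + d * P.privacyBudget ^ 2) * (P.e₀ / e) ^ 2 * P.ratio ^ 2

end

end Unlearning

/-!
Both convergence bounds come from a potential argument for projected stochastic gradient descent,
run on laws of iterates and lower integrals of non-negative quantities. Projection onto a closed
convex set does not increase the distance to a point of the set, so one step with stochastic
gradients bounded by `G` satisfies
`𝔼‖θ' - z‖² ≤ ‖θ - z‖² - 2 η ⟪𝔼 g, θ - z⟫ + η² G²` (`lintegral_norm_proj_step_sq_le`).
The mean gradient `Loss.riskGrad` inherits strong convexity and smoothness inequalities from the
losses by integration; the minimizers exist by coercivity and are critical points of the risk.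

For VRU, stationarity of `θ*` for the training risk makes the variance-reduced gradient an unbiased
estimate of the retain gradient (`integral_vruGrad`), and gives `‖θ* - θ*_r‖ ≤ ρ L / μ`, so that
`θ*_r` lies in the ball of projection, where the stochastic gradient has norm at most
`G = ρ L (1 + κ_ℓ)` (`norm_vruGrad_le`). Strong monotonicity and the step `1 / (μ (t + 1))` yield
`a_{t+1} ≤ (1 - 2 / (t + 1)) a_t + G² / (μ (t + 1))²` for the mean squared distance, hence
`a_T ≤ G² / (μ² T)` (`lintegral_vruIterLaw_le`). Smoothness turns this, with the added variance of
the Gaussian output noise, into an excess risk of order `M (1 + log T) e / T` with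
`M = T_e^max(VRU)`, and some `T` of order `(1 + M) log (3 + M)` makes this at most `e`.

For NFT, the quantity `‖θ_t - θ*_r‖² + 2 η t (𝓛_r(average) - 𝓛_r(θ*_r))` grows by at most `η² L²`
per step in expectation, by convexity along the running average (`nftPotential`). Its initial mean is
at most `(1 + d κ²) (ρ L / μ)²`, and the chosen step size balances the two terms, so the expected
excess risk is at most `ρ √(1 + d κ²) e₀ / √T`.

The comparison of the two expressions reduces to `(1 + a l) / (1 + a) = Θ(l)` for `a = d κ²` and
`l = log (1 / δ)`, both bounded away from `0` in terms of `ε₀` and `δ₀` (`one_add_mul_div_bounds`).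
-/

namespace Unlearning

variable {d s : ℕ}

/-! ### Euclidean projections -/

lemma proj_spec {C : Set (Model d)} (hC : IsClosed C) (hconv : Convex ℝ C) (hne : C.Nonempty)
    (x : Model d) : proj C x ∈ C ∧ ∀ z ∈ C, ‖x - proj C x‖ ≤ ‖x - z‖ := by
  have hex : ∃ y, y ∈ C ∧ ∀ z ∈ C, ‖x - y‖ ≤ ‖x - z‖ := by
    obtain ⟨y, hy, h⟩ := exists_norm_eq_iInf_of_complete_convex hne hC.isComplete hconv x
    refine ⟨y, hy, fun z hz => h ▸ ?_⟩
    exact ciInf_le ⟨0, by rintro _ ⟨w, rfl⟩; exact norm_nonneg _⟩ (⟨z, hz⟩ : C)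
  exact Classical.epsilon_spec hex

lemma inner_sub_proj_nonpos {C : Set (Model d)} (hC : IsClosed C) (hconv : Convex ℝ C)
    (x : Model d) {z : Model d} (hz : z ∈ C) :
    inner ℝ (x - proj C x) (z - proj C x) ≤ 0 := by
  obtain ⟨hmem, hmin⟩ := proj_spec hC hconv ⟨z, hz⟩ x
  have : Nonempty C := ⟨⟨z, hz⟩⟩
  refine (norm_eq_iInf_iff_real_inner_le_zero hconv hmem).1 ?_ z hz
  exact le_antisymm (le_ciInf fun w => hmin w w.2)
    (ciInf_le ⟨0, by rintro _ ⟨w, rfl⟩; exact norm_nonneg _⟩ (⟨_, hmem⟩ : C))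

lemma norm_proj_sub_le {C : Set (Model d)} (hC : IsClosed C) (hconv : Convex ℝ C)
    (x : Model d) {z : Model d} (hz : z ∈ C) : ‖proj C x - z‖ ≤ ‖x - z‖ := by
  have h := inner_sub_proj_nonpos hC hconv x hz
  have e : x - z = (x - proj C x) - (z - proj C x) := by abel
  have h2 : ‖x - z‖ ^ 2 = ‖x - proj C x‖ ^ 2 - 2 * inner ℝ (x - proj C x) (z - proj C x)
      + ‖z - proj C x‖ ^ 2 := by rw [e, norm_sub_sq_real]
  rw [norm_sub_rev z] at h2
  exact le_of_sq_le_sq (by nlinarith [sq_nonneg ‖x - proj C x‖]) (norm_nonneg _)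

lemma lipschitzWith_proj {C : Set (Model d)} (hC : IsClosed C) (hconv : Convex ℝ C)
    (hne : C.Nonempty) : LipschitzWith 1 (proj C) := by
  refine LipschitzWith.of_dist_le_mul fun x y => ?_
  rw [dist_eq_norm, dist_eq_norm, NNReal.coe_one, one_mul]
  have h1 := inner_sub_proj_nonpos hC hconv x (proj_spec hC hconv hne y).1
  have h2 := inner_sub_proj_nonpos hC hconv y (proj_spec hC hconv hne x).1
  set p := proj C x
  set q := proj C y
  have h3 : ‖p - q‖ ^ 2 ≤ inner ℝ (x - y) (p - q) := by
    rw [← real_inner_self_eq_norm_sq]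
    have e1 : inner ℝ (x - p) (q - p) = - inner ℝ (x - p) (p - q) := by
      rw [← inner_neg_right, neg_sub]
    have e2 : inner ℝ (x - y) (p - q)
        = inner ℝ (x - p) (p - q) - inner ℝ (y - q) (p - q) + inner ℝ (p - q) (p - q) := by
      rw [← inner_sub_left, ← inner_add_left]; congr 1; abel
    linarith
  have h4 := real_inner_le_norm (x - y) (p - q)
  rcases (norm_nonneg (p - q)).eq_or_lt with h | h
  · rw [← h]; exact norm_nonneg _
  · exact le_of_mul_le_mul_right (by nlinarith) h

/-! ### Second moments of Gaussian perturbations -/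

lemma integrable_norm_sq_stdGaussian :
    Integrable (fun z : Model d => ‖z‖ ^ 2) (stdGaussian (Model d)) :=
  (IsGaussian.memLp_two_id (μ := stdGaussian (Model d))).integrable_norm_pow (by norm_num)

lemma integral_norm_sq_stdGaussian : ∫ z, ‖z‖ ^ 2 ∂stdGaussian (Model d) = d := by
  have hL : ∀ i : Fin d, MemLp (fun z : Model d => z i) 2 (stdGaussian (Model d)) := fun i =>
    (EuclideanSpace.proj (𝕜 := ℝ) i).comp_memLp' (IsGaussian.memLp_two_id)
  have hi : ∀ i : Fin d, ∫ z : Model d, z i ^ 2 ∂stdGaussian (Model d) = 1 := by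
    intro i
    set Λ : StrongDual ℝ (Model d) := innerSL ℝ (EuclideanSpace.single i (1 : ℝ))
    have hΛ : ∀ z : Model d, Λ z = z i := fun z => by simp [Λ, EuclideanSpace.inner_single_left]
    have hv := variance_dual_stdGaussian Λ
    rw [variance_of_integral_eq_zero Λ.continuous.aemeasurable
      (integral_strongDual_stdGaussian Λ)] at hv
    have hn : ‖Λ‖ = 1 := by rw [innerSL_apply_norm]; simp
    simpa [hΛ, hn] using hv
  simp_rw [EuclideanSpace.real_norm_sq_eq]
  rw [integral_finsetSum _ fun i _ => (hL i).integrable_sq]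
  simp [hi]

/-- The second moment of a Gaussian vector around an arbitrary centre. -/
lemma lintegral_norm_add_smul_sq_stdGaussian (v : Model d) (σ : ℝ) :
    ∫⁻ z, ENNReal.ofReal (‖v + σ • z‖ ^ 2) ∂stdGaussian (Model d)
      = ENNReal.ofReal (‖v‖ ^ 2 + σ ^ 2 * d) := by
  have e : ∀ z : Model d, ‖v + σ • z‖ ^ 2
      = ‖v‖ ^ 2 + 2 * (σ * innerSL ℝ v z) + σ ^ 2 * ‖z‖ ^ 2 := by
    intro z
    rw [norm_add_sq_real, inner_smul_right, norm_smul, mul_pow, Real.norm_eq_abs, sq_abs,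
      innerSL_apply_apply]
  have hi : Integrable (fun z => innerSL ℝ v z) (stdGaussian (Model d)) :=
    (innerSL ℝ v).integrable_comp IsGaussian.integrable_id
  have h1 : Integrable (fun z : Model d => ‖v‖ ^ 2 + 2 * (σ * innerSL ℝ v z))
      (stdGaussian (Model d)) := (integrable_const _).add ((hi.const_mul _).const_mul _)
  have h2 : Integrable (fun z : Model d => σ ^ 2 * ‖z‖ ^ 2) (stdGaussian (Model d)) :=
    integrable_norm_sq_stdGaussian.const_mul _
  simp_rw [e]
  have h3 : Integrable (fun z : Model d => ‖v‖ ^ 2 + 2 * (σ * innerSL ℝ v z) + σ ^ 2 * ‖z‖ ^ 2)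
      (stdGaussian (Model d)) := h1.add h2
  rw [← ofReal_integral_eq_lintegral_ofReal h3
    (ae_of_all _ fun z => le_of_le_of_eq (sq_nonneg ‖v + σ • z‖) (e z))]
  congr 1
  rw [integral_add h1 h2, integral_add (integrable_const _) ((hi.const_mul _).const_mul _),
    integral_const_mul, integral_const_mul, integral_const_mul, integral_norm_sq_stdGaussian,
    integral_strongDual_stdGaussian]
  simp

/-! ### Regular losses and their risks -/

namespace Loss.IsRegular

variable {ℓ : Loss d s} {μ β L : ℝ}

lemma hasGradientAt (h : ℓ.IsRegular μ β L) (θ : Model d) (ξ : Data s) :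
    HasGradientAt (fun ϑ => ℓ.toFun ϑ ξ) (ℓ.grad θ ξ) θ :=
  (h.differentiable ξ θ).hasGradientAt

lemma continuous_grad (h : ℓ.IsRegular μ β L) (ξ : Data s) :
    Continuous fun θ => ℓ.grad θ ξ := by
  refine (LipschitzWith.of_dist_le_mul (K := β.toNNReal) fun x y => ?_).continuous
  rw [dist_eq_norm, dist_eq_norm]
  exact (h.smooth ξ x y).trans
    (mul_le_mul_of_nonneg_right (Real.le_coe_toNNReal β) (norm_nonneg _))

/-- The gradient is measurable in the sample, as a limit of difference quotients. -/
lemma measurable_grad (h : ℓ.IsRegular μ β L) (θ : Model d) : Measurable (ℓ.grad θ) := by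
  have hcoord : ∀ i : Fin d, Measurable fun ξ => ℓ.grad θ ξ i := by
    intro i
    set v : Model d := EuclideanSpace.single i (1 : ℝ)
    refine measurable_of_tendsto_metrizable
      (f := fun (n : ℕ) ξ => (n : ℝ) • (ℓ.toFun (θ + (n : ℝ)⁻¹ • v) ξ - ℓ.toFun θ ξ))
      (fun n => ((h.measurable (θ + (n : ℝ)⁻¹ • v)).sub (h.measurable θ)).const_smul (n : ℝ)) ?_
    rw [tendsto_pi_nhds]
    intro ξ
    have hlim := (h.hasGradientAt θ ξ).hasFDerivAt.lim v (c := fun n : ℕ => (n : ℝ)) (l := atTop)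
      (by simpa using tendsto_natCast_atTop_atTop)
    simpa [v, EuclideanSpace.inner_single_right] using hlim
  have : ℓ.grad θ = fun ξ => WithLp.toLp 2 fun i => ℓ.grad θ ξ i := rfl
  rw [this]
  exact (WithLp.measurable_toLp 2 _).comp (measurable_pi_lambda _ hcoord)

lemma measurable_grad_uncurry (h : ℓ.IsRegular μ β L) :
    Measurable fun q : Model d × Data s => ℓ.grad q.1 q.2 :=
  measurable_uncurry_of_continuous_of_measurable h.continuous_grad h.measurable_grad

lemma norm_grad_le (h : ℓ.IsRegular μ β L) (hL : 0 < L) {θ : Model d} (hθ : θ ∈ ℓ.dom)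
    (ξ : Data s) : ‖ℓ.grad θ ξ‖ ≤ L := by
  have hint : ∀ x ∈ interior ℓ.dom, ‖ℓ.grad x ξ‖ ≤ L := by
    intro x hx
    have hx' : ℓ.dom ∈ 𝓝 x := mem_interior_iff_mem_nhds.1 hx
    have h1 : ‖fderiv ℝ (fun ϑ => ℓ.toFun ϑ ξ) x‖ ≤ L :=
      norm_fderiv_le_of_lip' ℝ hL.le <| by
        filter_upwards [hx'] with y hy
        exact h.lipschitz ξ y hy x (interior_subset hx)
    rwa [← toDual_gradient, LinearIsometryEquiv.norm_map] at h1
  have hcl : θ ∈ closure (interior ℓ.dom) := by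
    rw [h.dom_convex.closure_interior_eq_closure_of_nonempty_interior h.dom_interior]
    exact subset_closure hθ
  exact closure_minimal (s := interior ℓ.dom) (t := {x | ‖ℓ.grad x ξ‖ ≤ L}) hint
    (isClosed_le (h.continuous_grad ξ).norm continuous_const) hcl

lemma integrable_grad (h : ℓ.IsRegular μ β L) (hL : 0 < L) (D : Measure (Data s))
    [IsFiniteMeasure D] (θ : Model d) : Integrable (ℓ.grad θ) D := by
  obtain ⟨x, hx⟩ := h.dom_interior
  refine Integrable.of_bound (h.measurable_grad θ).aestronglyMeasurable (β * ‖θ - x‖ + L)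
    (ae_of_all _ fun ξ => ?_)
  have h1 : ‖ℓ.grad θ ξ - ℓ.grad x ξ‖ ≤ β * ‖θ - x‖ := h.smooth ξ θ x
  have h2 := h.norm_grad_le hL (interior_subset hx) ξ
  calc ‖ℓ.grad θ ξ‖ = ‖(ℓ.grad θ ξ - ℓ.grad x ξ) + ℓ.grad x ξ‖ := by rw [sub_add_cancel]
    _ ≤ _ := (norm_add_le _ _).trans (add_le_add h1 h2)

end Loss.IsRegular

/-- The mean gradient `𝔼_{ξ ∼ D} ∇ℓ(θ, ξ)`. -/
noncomputable def Loss.riskGrad (ℓ : Loss d s) (D : Measure (Data s)) (θ : Model d) : Model d :=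
  ∫ ξ, ℓ.grad θ ξ ∂D

namespace Loss.IsRegular

variable {ℓ : Loss d s} {μ β L : ℝ}

section Risk

variable {D : Measure (Data s)} [IsProbabilityMeasure D]

/-- Integrability of the first-order expansions of the loss; see `integral_affine`. -/
lemma integrable_affine (h : ℓ.IsRegular μ β L) (hL : 0 < L)
    (hD : ∀ θ, Integrable (ℓ.toFun θ) D) (θ v : Model d) (c : ℝ) :
    Integrable (fun ξ => ℓ.toFun θ ξ + inner ℝ (ℓ.grad θ ξ) v + c) D :=
  ((hD θ).add ((h.integrable_grad hL D θ).inner_const v)).add (integrable_const c)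

lemma integral_affine (h : ℓ.IsRegular μ β L) (hL : 0 < L)
    (hD : ∀ θ, Integrable (ℓ.toFun θ) D) (θ v : Model d) (c : ℝ) :
    ∫ ξ, (ℓ.toFun θ ξ + inner ℝ (ℓ.grad θ ξ) v + c) ∂D
      = ℓ.risk D θ + inner ℝ (ℓ.riskGrad D θ) v + c := by
  have hg := h.integrable_grad hL D θ
  have hi : ∫ ξ, inner ℝ (ℓ.grad θ ξ) v ∂D = inner ℝ (ℓ.riskGrad D θ) v := by
    simp_rw [real_inner_comm v]
    exact integral_inner hg v
  have hs : Integrable (fun ξ => ℓ.toFun θ ξ + inner ℝ (ℓ.grad θ ξ) v) D :=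
    (hD θ).add (hg.inner_const v)
  rw [integral_add hs (integrable_const c), integral_add (hD θ) (hg.inner_const v), hi]
  simp [Loss.risk]

lemma risk_ge (h : ℓ.IsRegular μ β L) (hL : 0 < L) (hD : ∀ θ, Integrable (ℓ.toFun θ) D)
    (θ θ' : Model d) : ℓ.risk D θ + inner ℝ (ℓ.riskGrad D θ) (θ' - θ) + μ / 2 * ‖θ' - θ‖ ^ 2
      ≤ ℓ.risk D θ' := by
  rw [← h.integral_affine hL hD]
  exact integral_mono (h.integrable_affine hL hD _ _ _) (hD θ') fun ξ => h.strongConvex ξ θ θ'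

/-- Quadratic upper bound on the risk. The factor `β` (rather than the optimal `β / 2`) comes from
combining convexity with the Lipschitz bound on the gradient. -/
lemma risk_le (h : ℓ.IsRegular μ β L) (hμ : 0 < μ) (hL : 0 < L)
    (hD : ∀ θ, Integrable (ℓ.toFun θ) D) (θ θ' : Model d) :
    ℓ.risk D θ' ≤ ℓ.risk D θ + inner ℝ (ℓ.riskGrad D θ) (θ' - θ) + β * ‖θ' - θ‖ ^ 2 := by
  rw [← h.integral_affine hL hD]
  refine integral_mono (hD θ') (h.integrable_affine hL hD _ _ _) fun ξ => ?_
  have h1 : ℓ.toFun θ ξ ≥ ℓ.toFun θ' ξ + inner ℝ (ℓ.grad θ' ξ) (θ - θ')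
    + μ / 2 * ‖θ - θ'‖ ^ 2 := h.strongConvex ξ θ' θ
  have h2 : ‖ℓ.grad θ' ξ - ℓ.grad θ ξ‖ ≤ β * ‖θ' - θ‖ := h.smooth ξ θ' θ
  have h3 := real_inner_le_norm (ℓ.grad θ' ξ - ℓ.grad θ ξ) (θ' - θ)
  have h4 : inner ℝ (ℓ.grad θ' ξ) (θ - θ') = - inner ℝ (ℓ.grad θ' ξ) (θ' - θ) := by
    rw [← inner_neg_right, neg_sub]
  have h5 := mul_le_mul_of_nonneg_right h2 (norm_nonneg (θ' - θ))
  rw [inner_sub_left] at h3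
  have h6 : 0 ≤ μ / 2 * ‖θ - θ'‖ ^ 2 := by positivity
  simp only
  nlinarith

lemma continuous_risk (h : ℓ.IsRegular μ β L) (hμ : 0 < μ) (hL : 0 < L)
    (hD : ∀ θ, Integrable (ℓ.toFun θ) D) : Continuous (ℓ.risk D) := by
  rw [continuous_iff_continuousAt]
  intro θ
  have hlow : Tendsto (fun θ' => ℓ.risk D θ + inner ℝ (ℓ.riskGrad D θ) (θ' - θ)
      + μ / 2 * ‖θ' - θ‖ ^ 2) (𝓝 θ) (𝓝 (ℓ.risk D θ)) := by
    have : Continuous fun θ' => ℓ.risk D θ + inner ℝ (ℓ.riskGrad D θ) (θ' - θ)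
      + μ / 2 * ‖θ' - θ‖ ^ 2 := by fun_prop
    simpa using this.tendsto θ
  have hup : Tendsto (fun θ' => ℓ.risk D θ + inner ℝ (ℓ.riskGrad D θ) (θ' - θ)
      + β * ‖θ' - θ‖ ^ 2) (𝓝 θ) (𝓝 (ℓ.risk D θ)) := by
    have : Continuous fun θ' => ℓ.risk D θ + inner ℝ (ℓ.riskGrad D θ) (θ' - θ)
      + β * ‖θ' - θ‖ ^ 2 := by fun_prop
    simpa using this.tendsto θ
  exact tendsto_of_tendsto_of_tendsto_of_le_of_le hlow hup (h.risk_ge hL hD θ)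
    (h.risk_le hμ hL hD θ)

/-- The minimizer of the risk exists: the risk is continuous and coercive. -/
lemma risk_opt_le (h : ℓ.IsRegular μ β L) (hμ : 0 < μ) (hL : 0 < L)
    (hD : ∀ θ, Integrable (ℓ.toFun θ) D) (θ : Model d) :
    ℓ.risk D (ℓ.opt D) ≤ ℓ.risk D θ := by
  have hex : ∃ θ, ∀ θ', ℓ.risk D θ ≤ ℓ.risk D θ' := by
    refine (h.continuous_risk hμ hL hD).exists_forall_le' (0 : Model d) ?_
    have hlarge : ∀ᶠ x : Model d in cocompact _, 2 * ‖ℓ.riskGrad D 0‖ / μ ≤ ‖x‖ :=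
      (tendsto_norm_cocompact_atTop (E := Model d)).eventually_ge_atTop _
    filter_upwards [hlarge] with x hx
    have h1 := h.risk_ge hL hD 0 x
    rw [sub_zero] at h1
    have h2 := neg_le_of_abs_le (abs_real_inner_le_norm (ℓ.riskGrad D 0) x)
    rw [div_le_iff₀ hμ] at hx
    nlinarith [norm_nonneg x]
  exact Classical.epsilon_spec hex θ

lemma riskGrad_opt (h : ℓ.IsRegular μ β L) (hμ : 0 < μ) (hβ : 0 < β) (hL : 0 < L)
    (hD : ∀ θ, Integrable (ℓ.toFun θ) D) : ℓ.riskGrad D (ℓ.opt D) = 0 := by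
  set g := ℓ.riskGrad D (ℓ.opt D) with hg
  -- A step against the gradient of length `1 / (2β)` would decrease the risk.
  have h1 := h.risk_le hμ hL hD (ℓ.opt D) (ℓ.opt D - (1 / (2 * β)) • g)
  have h2 := h.risk_opt_le hμ hL hD (ℓ.opt D - (1 / (2 * β)) • g)
  rw [sub_sub_cancel_left, norm_neg, norm_smul, inner_neg_right, inner_smul_right, ← hg,
    real_inner_self_eq_norm_sq, mul_pow, Real.norm_eq_abs, sq_abs] at h1
  have h3 : β * ((1 / (2 * β)) ^ 2 * ‖g‖ ^ 2) = 1 / (4 * β) * ‖g‖ ^ 2 := by field_simp; ring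
  have h4 : 1 / (2 * β) * ‖g‖ ^ 2 = 2 * (1 / (4 * β) * ‖g‖ ^ 2) := by field_simp; ring
  rw [h3, h4] at h1
  have h5 : 0 < 1 / (4 * β) := by positivity
  have h6 : ‖g‖ ^ 2 ≤ 0 := by
    by_contra! hc
    have := mul_pos h5 hc
    linarith
  have h7 : ‖g‖ = 0 := by nlinarith [norm_nonneg g]
  exact norm_eq_zero.1 h7

lemma norm_riskGrad_le (h : ℓ.IsRegular μ β L) (hL : 0 < L) {θ : Model d} (hθ : θ ∈ ℓ.dom) :
    ‖ℓ.riskGrad D θ‖ ≤ L := by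
  have := norm_integral_le_of_norm_le_const (μ := D) (ae_of_all _ (h.norm_grad_le hL hθ))
  simpa [Loss.riskGrad] using this

/-- Strong monotonicity of the mean gradient, at the minimizer. -/
lemma mul_norm_sub_opt_sq_le (h : ℓ.IsRegular μ β L) (hμ : 0 < μ) (hβ : 0 < β) (hL : 0 < L)
    (hD : ∀ θ, Integrable (ℓ.toFun θ) D) (θ : Model d) :
    μ * ‖θ - ℓ.opt D‖ ^ 2 ≤ inner ℝ (ℓ.riskGrad D θ) (θ - ℓ.opt D) := by
  have h1 := h.risk_ge hL hD θ (ℓ.opt D)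
  have h2 := h.risk_ge hL hD (ℓ.opt D) θ
  rw [h.riskGrad_opt hμ hβ hL hD, inner_zero_left] at h2
  rw [← neg_sub θ, inner_neg_right, norm_neg] at h1
  linarith

lemma risk_sub_opt_le_inner (h : ℓ.IsRegular μ β L) (hμ : 0 < μ) (hL : 0 < L)
    (hD : ∀ θ, Integrable (ℓ.toFun θ) D) (θ : Model d) :
    ℓ.risk D θ - ℓ.risk D (ℓ.opt D) ≤ inner ℝ (ℓ.riskGrad D θ) (θ - ℓ.opt D) := by
  have h1 := h.risk_ge hL hD θ (ℓ.opt D)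
  rw [← neg_sub θ, inner_neg_right, norm_neg] at h1
  have : 0 ≤ μ / 2 * ‖θ - ℓ.opt D‖ ^ 2 := by positivity
  linarith

lemma risk_sub_opt_le_norm_sq (h : ℓ.IsRegular μ β L) (hμ : 0 < μ) (hβ : 0 < β) (hL : 0 < L)
    (hD : ∀ θ, Integrable (ℓ.toFun θ) D) (θ : Model d) :
    ℓ.risk D θ - ℓ.risk D (ℓ.opt D) ≤ β * ‖θ - ℓ.opt D‖ ^ 2 := by
  have h1 := h.risk_le hμ hL hD (ℓ.opt D) θ
  rw [h.riskGrad_opt hμ hβ hL hD, inner_zero_left] at h1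
  linarith

lemma convexOn_risk (h : ℓ.IsRegular μ β L) (hμ : 0 < μ) (hL : 0 < L)
    (hD : ∀ θ, Integrable (ℓ.toFun θ) D) : ConvexOn ℝ Set.univ (ℓ.risk D) := by
  refine ⟨convex_univ, fun x _ y _ a b ha hb hab => ?_⟩
  set m := a • x + b • y
  have h1 := h.risk_ge hL hD m x
  have h2 := h.risk_ge hL hD m y
  have hx : 0 ≤ μ / 2 * ‖x - m‖ ^ 2 := by positivity
  have hy : 0 ≤ μ / 2 * ‖y - m‖ ^ 2 := by positivity
  have e : a * inner ℝ (ℓ.riskGrad D m) (x - m) + b * inner ℝ (ℓ.riskGrad D m) (y - m) = 0 := by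
    rw [← inner_smul_right, ← inner_smul_right, ← inner_add_right, smul_sub, smul_sub]
    have : a • x - a • m + (b • y - b • m) = 0 := by
      rw [sub_add_sub_comm, ← add_smul, hab, one_smul, sub_self]
    rw [this, inner_zero_right]
  have h3 : a * (ℓ.risk D m + inner ℝ (ℓ.riskGrad D m) (x - m)) ≤ a * ℓ.risk D x :=
    mul_le_mul_of_nonneg_left (by linarith) ha
  have h4 : b * (ℓ.risk D m + inner ℝ (ℓ.riskGrad D m) (y - m)) ≤ b * ℓ.risk D y :=
    mul_le_mul_of_nonneg_left (by linarith) hb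
  have h5 : ℓ.risk D m = a * ℓ.risk D m + b * ℓ.risk D m := by rw [← add_mul, hab, one_mul]
  simp only [smul_eq_mul]
  linarith

end Risk

/-! ### The original optimum -/

section Train

lemma integrable_trainDist {Dr Df : Measure (Data s)} {r : ℝ} {E : Type*} [NormedAddCommGroup E]
    {f : Data s → E} (hr : Integrable f Dr) (hf : Integrable f Df) : Integrable f (trainDist r Dr Df) :=
  (hf.smul_measure ENNReal.ofReal_ne_top).add_measure (hr.smul_measure ENNReal.ofReal_ne_top)

variable {Dr Df : Measure (Data s)} [IsProbabilityMeasure Dr] [IsProbabilityMeasure Df] {r : ℝ}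

lemma isProbabilityMeasure_trainDist (h0 : 0 < r) (h1 : r < 1) :
    IsProbabilityMeasure (trainDist r Dr Df) := by
  constructor
  simp only [trainDist, Measure.add_apply, Measure.smul_apply, measure_univ, smul_eq_mul, mul_one]
  rw [← ENNReal.ofReal_add h0.le (by linarith)]
  simp

/-- The stationarity of the original optimum expresses the mean retain gradient there through the
mean forget gradient; this makes the stochastic gradient of VRU unbiased. -/
lemma riskGrad_retain_opt_train (h : ℓ.IsRegular μ β L) (hμ : 0 < μ) (hβ : 0 < β) (hL : 0 < L)
    (h0 : 0 < r) (h1 : r < 1) (hr : ∀ θ, Integrable (ℓ.toFun θ) Dr)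
    (hf : ∀ θ, Integrable (ℓ.toFun θ) Df) :
    ℓ.riskGrad Dr (ℓ.opt (trainDist r Dr Df))
      = -((r / (1 - r)) • ℓ.riskGrad Df (ℓ.opt (trainDist r Dr Df))) := by
  have := isProbabilityMeasure_trainDist (Dr := Dr) (Df := Df) h0 h1
  have h2 := h.riskGrad_opt (D := trainDist r Dr Df) hμ hβ hL
    fun θ => integrable_trainDist (hr θ) (hf θ)
  set x := ℓ.opt (trainDist r Dr Df)
  have h3 : r • ℓ.riskGrad Df x + (1 - r) • ℓ.riskGrad Dr x = 0 := by
    rw [← h2]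
    simp only [Loss.riskGrad, trainDist]
    rw [integral_add_measure
      ((h.integrable_grad hL Df x).smul_measure ENNReal.ofReal_ne_top)
      ((h.integrable_grad hL Dr x).smul_measure ENNReal.ofReal_ne_top),
      integral_smul_measure, integral_smul_measure, ENNReal.toReal_ofReal h0.le,
      ENNReal.toReal_ofReal (by linarith)]
  have hne : (1 - r) ≠ 0 := by linarith
  rw [div_eq_inv_mul, mul_smul, ← smul_neg, eq_inv_smul_iff₀ hne]
  exact eq_neg_of_add_eq_zero_right h3

lemma norm_opt_train_sub_opt_retain_le (h : ℓ.IsRegular μ β L) (hμ : 0 < μ) (hβ : 0 < β)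
    (hL : 0 < L) (h0 : 0 < r) (h1 : r < 1) (hr : ∀ θ, Integrable (ℓ.toFun θ) Dr)
    (hf : ∀ θ, Integrable (ℓ.toFun θ) Df) (hdom : ℓ.opt (trainDist r Dr Df) ∈ ℓ.dom) :
    ‖ℓ.opt (trainDist r Dr Df) - ℓ.opt Dr‖ ≤ r / (1 - r) * (L / μ) := by
  have h2 := h.mul_norm_sub_opt_sq_le hμ hβ hL hr (ℓ.opt (trainDist r Dr Df))
  have hρ : 0 ≤ r / (1 - r) := div_nonneg h0.le (by linarith)
  have h3 : ‖ℓ.riskGrad Dr (ℓ.opt (trainDist r Dr Df))‖ ≤ r / (1 - r) * L := by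
    rw [h.riskGrad_retain_opt_train hμ hβ hL h0 h1 hr hf, norm_neg, norm_smul, Real.norm_eq_abs,
      abs_of_nonneg hρ]
    exact mul_le_mul_of_nonneg_left (h.norm_riskGrad_le hL hdom) hρ
  have h4 := real_inner_le_norm (ℓ.riskGrad Dr (ℓ.opt (trainDist r Dr Df)))
    (ℓ.opt (trainDist r Dr Df) - ℓ.opt Dr)
  set N := ‖ℓ.opt (trainDist r Dr Df) - ℓ.opt Dr‖
  have hN : 0 ≤ N := norm_nonneg _
  rw [← mul_div_assoc, le_div_iff₀ hμ]
  rcases hN.eq_or_lt with h' | h'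
  · rw [← h']; simp; positivity
  · refine le_of_mul_le_mul_right ?_ h'
    nlinarith [mul_le_mul_of_nonneg_right h3 hN]

end Train

end Loss.IsRegular

/-! ### One step of projected stochastic gradient descent -/

/-- One step of projected stochastic gradient descent with bounded stochastic gradients, in the
form used for both algorithms; `c` is a further non-negative term of a potential. -/
lemma lintegral_norm_proj_step_sq_le {Ω : Type*} [MeasurableSpace Ω] {D : Measure Ω}
    [IsProbabilityMeasure D] {C : Set (Model d)} (hC : IsClosed C) (hconv : Convex ℝ C)
    {g : Ω → Model d} (hg : Integrable g D) {G : ℝ} (hG : ∀ ω, ‖g ω‖ ≤ G)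
    (θ : Model d) {z : Model d} (hz : z ∈ C) (η : ℝ) {c : ℝ} (hc : 0 ≤ c) :
    ∫⁻ ω, ENNReal.ofReal (‖proj C (θ - η • g ω) - z‖ ^ 2 + c) ∂D
      ≤ ENNReal.ofReal (‖θ - z‖ ^ 2 - 2 * η * inner ℝ (∫ ω, g ω ∂D) (θ - z)
          + η ^ 2 * G ^ 2 + c) := by
  set B : ℝ := ‖θ - z‖ ^ 2 + η ^ 2 * G ^ 2 + c
  have hpt : ∀ ω, ‖proj C (θ - η • g ω) - z‖ ^ 2 + c
      ≤ B - 2 * η * inner ℝ (g ω) (θ - z) := by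
    intro ω
    have h1 := pow_le_pow_left₀ (norm_nonneg _) (norm_proj_sub_le hC hconv (θ - η • g ω) hz) 2
    have h2 : ‖θ - η • g ω - z‖ ^ 2
        = ‖θ - z‖ ^ 2 - 2 * η * inner ℝ (g ω) (θ - z) + η ^ 2 * ‖g ω‖ ^ 2 := by
      rw [show θ - η • g ω - z = (θ - z) - η • g ω by abel, norm_sub_sq_real, inner_smul_right,
        norm_smul, mul_pow, Real.norm_eq_abs, sq_abs, real_inner_comm]
      ring
    have h3 : η ^ 2 * ‖g ω‖ ^ 2 ≤ η ^ 2 * G ^ 2 :=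
      mul_le_mul_of_nonneg_left (pow_le_pow_left₀ (norm_nonneg _) (hG ω) 2) (sq_nonneg _)
    simp only [B]
    linarith
  have hi : Integrable (fun ω => 2 * η * inner ℝ (g ω) (θ - z)) D :=
    (hg.inner_const (θ - z)).const_mul _
  calc ∫⁻ ω, ENNReal.ofReal (‖proj C (θ - η • g ω) - z‖ ^ 2 + c) ∂D
      ≤ ∫⁻ ω, ENNReal.ofReal (B - 2 * η * inner ℝ (g ω) (θ - z)) ∂D :=
        lintegral_mono fun ω => ENNReal.ofReal_le_ofReal (hpt ω)
    _ = ENNReal.ofReal (∫ ω, (B - 2 * η * inner ℝ (g ω) (θ - z)) ∂D) :=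
        (ofReal_integral_eq_lintegral_ofReal ((integrable_const B).sub hi)
          (ae_of_all _ fun ω => le_trans (by positivity) (hpt ω))).symm
    _ = _ := by
        have hin : ∫ ω, inner ℝ (g ω) (θ - z) ∂D = inner ℝ (∫ ω, g ω ∂D) (θ - z) := by
          simp_rw [real_inner_comm (θ - z)]
          exact integral_inner hg _
        rw [integral_sub (integrable_const B) hi, integral_const_mul, hin]
        simp only [integral_const, probReal_univ, smul_eq_mul, one_mul, B]
        congr 1
        ring

/-! ### The class of losses -/

namespace Params.Valid

variable {P : Params}

lemma β_pos (hP : P.Valid) : 0 < P.β := hP.μ_pos.trans_le hP.μ_le_β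

lemma ratio_pos (hP : P.Valid) : 0 < P.ratio :=
  div_pos hP.rf_pos (sub_pos.2 hP.rf_lt_one)

lemma one_le_condNumber (hP : P.Valid) : 1 ≤ P.condNumber :=
  (one_le_div hP.μ_pos).2 hP.μ_le_β

lemma e₀_pos (hP : P.Valid) : 0 < P.e₀ := div_pos (pow_pos hP.L_pos 2) hP.μ_pos

end Params.Valid

lemma lintegral_map_prod {α β γ : Type*} [MeasurableSpace α] [MeasurableSpace β]
    [MeasurableSpace γ] {κ : Measure α} {ν : Measure β} [SFinite ν] {f : α × β → γ}
    (hf : Measurable f) {g : γ → ℝ≥0∞} (hg : Measurable g) :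
    ∫⁻ c, g c ∂((κ.prod ν).map f) = ∫⁻ a, ∫⁻ b, g (f (a, b)) ∂ν ∂κ := by
  rw [lintegral_map hg hf]
  exact lintegral_prod _ (hg.comp hf).aemeasurable

lemma excess_nonneg {P : Params} {ℓ : Loss d s} {Dr : Measure (Data s)}
    [IsProbabilityMeasure Dr] (hP : P.Valid) (hℓ : ℓ.IsRegular P.μ P.β P.L)
    (hr : ∀ θ, Integrable (ℓ.toFun θ) Dr) (θ : Model d) :
    0 ≤ ℓ.risk Dr θ - ℓ.risk Dr (ℓ.opt Dr) :=
  sub_nonneg.2 (hℓ.risk_opt_le hP.μ_pos hP.L_pos hr θ)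

/-! ### Variance-Reduced Unlearning -/

section VRU

variable {P : Params} {ℓ : Loss d s} {Dr Df : Measure (Data s)}

lemma isClosed_vruBall (θstar : Model d) :
    IsClosed (Metric.closedBall θstar (P.ratio * (P.L / P.μ))) := Metric.isClosed_closedBall

lemma vruBall_radius_nonneg (hP : P.Valid) : 0 ≤ P.ratio * (P.L / P.μ) :=
  mul_nonneg hP.ratio_pos.le (div_nonneg hP.L_pos.le hP.μ_pos.le)

lemma measurable_vruStep (hP : P.Valid) (hℓ : ℓ.IsRegular P.μ P.β P.L) (θstar : Model d) (t : ℕ) :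
    Measurable fun q : Model d × Data s × Data s => vruStep P ℓ θstar t q.1 q.2.1 q.2.2 := by
  have h1 : Measurable fun q : Model d × Data s × Data s => ℓ.grad q.1 q.2.1 :=
    hℓ.measurable_grad_uncurry.comp (measurable_fst.prodMk (measurable_fst.comp measurable_snd))
  have h2 : Measurable fun q : Model d × Data s × Data s => ℓ.grad θstar q.2.1 :=
    (hℓ.measurable_grad θstar).comp (measurable_fst.comp measurable_snd)
  have h3 : Measurable fun q : Model d × Data s × Data s => ℓ.grad θstar q.2.2 :=
    (hℓ.measurable_grad θstar).comp (measurable_snd.comp measurable_snd)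
  refine (lipschitzWith_proj (isClosed_vruBall θstar) (convex_closedBall _ _)
    ⟨θstar, Metric.mem_closedBall_self (vruBall_radius_nonneg hP)⟩).continuous.measurable.comp ?_
  exact measurable_fst.sub (((h1.sub h2).sub (h3.const_smul P.ratio)).const_smul
    (1 / (P.μ * ((t : ℝ) + 1))))

lemma isProbabilityMeasure_vruIterLaw [IsProbabilityMeasure Dr] [IsProbabilityMeasure Df] (hP : P.Valid) (hℓ : ℓ.IsRegular P.μ P.β P.L)
    (θstar : Model d) (t : ℕ) : IsProbabilityMeasure (vruIterLaw P ℓ Dr Df θstar t) := by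
  induction t with
  | zero => exact Measure.dirac.isProbabilityMeasure
  | succ t ih => exact Measure.isProbabilityMeasure_map (measurable_vruStep hP hℓ θstar t).aemeasurable

lemma ae_vruIterLaw_mem_ball (hP : P.Valid) (hℓ : ℓ.IsRegular P.μ P.β P.L)
    (θstar : Model d) (t : ℕ) : ∀ᵐ θ ∂vruIterLaw P ℓ Dr Df θstar t,
      θ ∈ Metric.closedBall θstar (P.ratio * (P.L / P.μ)) := by
  have hself := Metric.mem_closedBall_self (x := θstar) (vruBall_radius_nonneg hP)
  cases t with
  | zero => exact (ae_dirac_iff (isClosed_vruBall θstar).measurableSet).2 hself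
  | succ t =>
    exact (ae_map_iff (measurable_vruStep hP hℓ θstar t).aemeasurable
      (isClosed_vruBall θstar).measurableSet).2 (ae_of_all _ fun q =>
        (proj_spec (isClosed_vruBall θstar) (convex_closedBall _ _) ⟨θstar, hself⟩ _).1)

/-- On the ball around `θ*`, smoothness bounds the variance-reduced stochastic gradient in terms
of the forget ratio. -/
lemma norm_vruGrad_le (hP : P.Valid) (hℓ : ℓ.IsRegular P.μ P.β P.L) {θstar θ : Model d}
    (hstar : θstar ∈ ℓ.dom) (hθ : θ ∈ Metric.closedBall θstar (P.ratio * (P.L / P.μ)))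
    (ξr ξf : Data s) :
    ‖vruGrad P ℓ θstar θ ξr ξf‖ ≤ P.ratio * P.L * (1 + P.condNumber) := by
  have h1 : ‖ℓ.grad θ ξr - ℓ.grad θstar ξr‖ ≤ P.β * ‖θ - θstar‖ := hℓ.smooth ξr θ θstar
  rw [mem_closedBall_iff_norm] at hθ
  have h2 : ‖P.ratio • ℓ.grad θstar ξf‖ ≤ P.ratio * P.L := by
    rw [norm_smul, Real.norm_eq_abs, abs_of_pos hP.ratio_pos]
    exact mul_le_mul_of_nonneg_left (hℓ.norm_grad_le hP.L_pos hstar ξf) hP.ratio_pos.le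
  have h3 := mul_le_mul_of_nonneg_left hθ hP.β_pos.le
  calc ‖vruGrad P ℓ θstar θ ξr ξf‖ ≤ _ := norm_sub_le _ _
    _ ≤ P.β * (P.ratio * (P.L / P.μ)) + P.ratio * P.L := by linarith
    _ = _ := by rw [Params.condNumber]; field_simp; ring

variable [IsProbabilityMeasure Dr] [IsProbabilityMeasure Df]

lemma integrable_vruGrad (hP : P.Valid) (hℓ : ℓ.IsRegular P.μ P.β P.L) (θstar θ : Model d) :
    Integrable (fun ω : Data s × Data s => vruGrad P ℓ θstar θ ω.1 ω.2) (Dr.prod Df) :=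
  (((hℓ.integrable_grad hP.L_pos Dr θ).comp_fst Df).sub
    ((hℓ.integrable_grad hP.L_pos Dr θstar).comp_fst Df)).sub
      (((hℓ.integrable_grad hP.L_pos Df θstar).comp_snd Dr).smul P.ratio)

/-- The variance-reduced stochastic gradient is an unbiased estimate of the gradient of the
retain risk. -/
lemma integral_vruGrad (hP : P.Valid) (hℓ : ℓ.IsRegular P.μ P.β P.L)
    (hr : ∀ θ, Integrable (ℓ.toFun θ) Dr) (hf : ∀ θ, Integrable (ℓ.toFun θ) Df) (θ : Model d) :
    ∫ ω, vruGrad P ℓ (ℓ.opt (trainDist P.rf Dr Df)) θ ω.1 ω.2 ∂(Dr.prod Df)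
      = ℓ.riskGrad Dr θ := by
  have hopt := hℓ.riskGrad_retain_opt_train hP.μ_pos hP.β_pos hP.L_pos hP.rf_pos hP.rf_lt_one hr hf
  set x := ℓ.opt (trainDist P.rf Dr Df)
  have i1 : Integrable (fun ω : Data s × Data s => ℓ.grad θ ω.1) (Dr.prod Df) :=
    (hℓ.integrable_grad hP.L_pos Dr θ).comp_fst Df
  have i2 : Integrable (fun ω : Data s × Data s => ℓ.grad x ω.1) (Dr.prod Df) :=
    (hℓ.integrable_grad hP.L_pos Dr x).comp_fst Df
  have i12 : Integrable (fun ω : Data s × Data s => ℓ.grad θ ω.1 - ℓ.grad x ω.1) (Dr.prod Df) :=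
    i1.sub i2
  have i3 : Integrable (fun ω : Data s × Data s => P.ratio • ℓ.grad x ω.2) (Dr.prod Df) :=
    ((hℓ.integrable_grad hP.L_pos Df x).comp_snd Dr).smul P.ratio
  simp only [vruGrad]
  rw [integral_sub i12 i3, integral_sub i1 i2, integral_fun_fst, integral_fun_fst,
    integral_fun_snd (fun y => P.ratio • ℓ.grad x y), integral_smul]
  simp only [probReal_univ, one_smul]
  change ℓ.riskGrad Dr θ - ℓ.riskGrad Dr x - P.ratio • ℓ.riskGrad Df x = _
  rw [hopt, Params.ratio]
  abel

/-- One update of VRU contracts the expected squared distance to the retain optimum by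
`1 - 2 / (t + 1)`, up to the second moment of the scaled stochastic gradient. -/
lemma lintegral_vruStep_le (hP : P.Valid) (hℓ : ℓ ∈ lossClass P d Dr Df) (t : ℕ) {θ : Model d}
    (hθ : θ ∈ Metric.closedBall (ℓ.opt (trainDist P.rf Dr Df)) (P.ratio * (P.L / P.μ))) :
    ∫⁻ ω, ENNReal.ofReal (‖vruStep P ℓ (ℓ.opt (trainDist P.rf Dr Df)) t θ ω.1 ω.2
        - ℓ.opt Dr‖ ^ 2) ∂(Dr.prod Df)
      ≤ ENNReal.ofReal ((1 - 2 / ((t : ℝ) + 1)) * ‖θ - ℓ.opt Dr‖ ^ 2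
          + (P.ratio * P.L * (1 + P.condNumber)) ^ 2 / P.μ ^ 2 / ((t : ℝ) + 1) ^ 2) := by
  obtain ⟨hreg, hr, hf, hstar, -⟩ := hℓ
  have hμ := hP.μ_pos
  set x := ℓ.opt (trainDist P.rf Dr Df)
  have hz : ℓ.opt Dr ∈ Metric.closedBall x (P.ratio * (P.L / P.μ)) := by
    rw [mem_closedBall_iff_norm, norm_sub_rev]
    exact hreg.norm_opt_train_sub_opt_retain_le hμ hP.β_pos hP.L_pos hP.rf_pos hP.rf_lt_one hr hf
      hstar
  have h1 := lintegral_norm_proj_step_sq_le (D := Dr.prod Df) (isClosed_vruBall (P := P) x)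
    (convex_closedBall _ _) (integrable_vruGrad hP hreg x θ)
    (fun ω => norm_vruGrad_le hP hreg hstar hθ ω.1 ω.2) θ hz
    (1 / (P.μ * ((t : ℝ) + 1))) le_rfl
  simp only [add_zero] at h1
  refine h1.trans (ENNReal.ofReal_le_ofReal ?_)
  rw [integral_vruGrad hP hreg hr hf]
  have h2 := hreg.mul_norm_sub_opt_sq_le hμ hP.β_pos hP.L_pos hr θ
  have ht : (0 : ℝ) < (t : ℝ) + 1 := by positivity
  have h3 : 2 * (1 / (P.μ * ((t : ℝ) + 1))) * (P.μ * ‖θ - ℓ.opt Dr‖ ^ 2)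
      ≤ 2 * (1 / (P.μ * ((t : ℝ) + 1))) * inner ℝ (ℓ.riskGrad Dr θ) (θ - ℓ.opt Dr) :=
    mul_le_mul_of_nonneg_left h2 (by positivity)
  have h4 : 2 * (1 / (P.μ * ((t : ℝ) + 1))) * (P.μ * ‖θ - ℓ.opt Dr‖ ^ 2)
      = 2 / ((t : ℝ) + 1) * ‖θ - ℓ.opt Dr‖ ^ 2 := by field_simp
  have h5 : (1 / (P.μ * ((t : ℝ) + 1))) ^ 2 * (P.ratio * P.L * (1 + P.condNumber)) ^ 2
      = (P.ratio * P.L * (1 + P.condNumber)) ^ 2 / P.μ ^ 2 / ((t : ℝ) + 1) ^ 2 := by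
    field_simp
  linarith

/-- The mean squared distance of the VRU iterates to the retain optimum decays like `1 / t`. -/
lemma lintegral_vruIterLaw_le (hP : P.Valid) (hℓ : ℓ ∈ lossClass P d Dr Df) (t : ℕ) :
    ∫⁻ θ, ENNReal.ofReal (‖θ - ℓ.opt Dr‖ ^ 2)
        ∂vruIterLaw P ℓ Dr Df (ℓ.opt (trainDist P.rf Dr Df)) (t + 1)
      ≤ ENNReal.ofReal ((P.ratio * P.L * (1 + P.condNumber)) ^ 2 / P.μ ^ 2 / ((t : ℝ) + 1)) := by
  have hreg := hℓ.1
  set x := ℓ.opt (trainDist P.rf Dr Df)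
  set A : ℝ := (P.ratio * P.L * (1 + P.condNumber)) ^ 2 / P.μ ^ 2 with hA
  have hA0 : 0 ≤ A := by positivity
  have hrec : ∀ t, ∫⁻ θ, ENNReal.ofReal (‖θ - ℓ.opt Dr‖ ^ 2) ∂vruIterLaw P ℓ Dr Df x (t + 1)
      ≤ ∫⁻ θ, ENNReal.ofReal ((1 - 2 / ((t : ℝ) + 1)) * ‖θ - ℓ.opt Dr‖ ^ 2
          + A / ((t : ℝ) + 1) ^ 2) ∂vruIterLaw P ℓ Dr Df x t := by
    intro t
    have := isProbabilityMeasure_vruIterLaw (Dr := Dr) (Df := Df) hP hreg x t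
    have hm : Measurable fun θ : Model d => ENNReal.ofReal (‖θ - ℓ.opt Dr‖ ^ 2) := by fun_prop
    rw [vruIterLaw, lintegral_map_prod (measurable_vruStep hP hreg x t) hm]
    refine lintegral_mono_ae ?_
    filter_upwards [ae_vruIterLaw_mem_ball (Dr := Dr) (Df := Df) hP hreg x t] with θ hθ
    exact lintegral_vruStep_le hP hℓ t hθ
  induction t with
  | zero =>
    refine (hrec 0).trans ?_
    have := isProbabilityMeasure_vruIterLaw (Dr := Dr) (Df := Df) hP hreg x 0
    -- At the first step the factor `1 - 2 / (t + 1)` is `-1`: the initial distance plays no role.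
    calc _ ≤ ∫⁻ θ, ENNReal.ofReal A ∂vruIterLaw P ℓ Dr Df x 0 := by
          refine lintegral_mono fun θ => ENNReal.ofReal_le_ofReal ?_
          have := sq_nonneg ‖θ - ℓ.opt Dr‖
          norm_num
      _ = _ := by simp
  | succ t ih =>
    refine (hrec (t + 1)).trans ?_
    have := isProbabilityMeasure_vruIterLaw (Dr := Dr) (Df := Df) hP hreg x (t + 1)
    push_cast
    have ht : (0 : ℝ) ≤ t := t.cast_nonneg
    have hc : (0 : ℝ) ≤ 1 - 2 / ((t : ℝ) + 1 + 1) := by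
      rw [sub_nonneg, div_le_one (by positivity)]; linarith
    have hb : (0 : ℝ) ≤ A / ((t : ℝ) + 1 + 1) ^ 2 := by positivity
    simp_rw [ENNReal.ofReal_add (mul_nonneg hc (sq_nonneg _)) hb, ENNReal.ofReal_mul hc]
    rw [lintegral_add_right _ measurable_const, lintegral_const_mul _ (by fun_prop),
      lintegral_const, measure_univ, mul_one]
    refine (add_le_add_left (mul_le_mul_right ih _) _).trans ?_
    rw [← ENNReal.ofReal_mul hc, ← ENNReal.ofReal_add (by positivity) hb]
    refine ENNReal.ofReal_le_ofReal ?_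
    have e : A / ((t : ℝ) + 1 + 1) - ((1 - 2 / ((t : ℝ) + 1 + 1)) * (A / ((t : ℝ) + 1))
        + A / ((t : ℝ) + 1 + 1) ^ 2) = A / (((t : ℝ) + 1) * ((t : ℝ) + 1 + 1) ^ 2) := by
      field_simp
      ring
    have : 0 ≤ A / (((t : ℝ) + 1) * ((t : ℝ) + 1 + 1) ^ 2) := by positivity
    linarith

lemma expectedExcess_VRU_le (hP : P.Valid) (hℓ : ℓ ∈ lossClass P d Dr Df) {T : ℕ} (hT : 1 ≤ T) :
    expectedExcess ℓ Dr (VRU P T ℓ Dr Df)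
      ≤ ENNReal.ofReal (P.β * ((P.ratio * P.L * (1 + P.condNumber)) ^ 2 / P.μ ^ 2 / T
          + (P.ratio * P.ν T * P.privacyBudget) ^ 2 * d)) := by
  obtain ⟨t, rfl⟩ : ∃ t, T = t + 1 := ⟨T - 1, by omega⟩
  have hreg := hℓ.1
  have hr := hℓ.2.1
  have hβ := hP.β_pos
  have hiter := lintegral_vruIterLaw_le hP hℓ t
  rw [VRU]
  set x := ℓ.opt (trainDist P.rf Dr Df)
  set σ := P.ratio * P.ν (t + 1) * P.privacyBudget
  have := isProbabilityMeasure_vruIterLaw (Dr := Dr) (Df := Df) hP hreg x (t + 1)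
  have hadd : Measurable fun q : Model d × Model d => q.1 + σ • q.2 := by fun_prop
  have hm : Measurable fun θ : Model d => ENNReal.ofReal (‖θ - ℓ.opt Dr‖ ^ 2) := by fun_prop
  calc expectedExcess ℓ Dr _
      ≤ ∫⁻ θ, ENNReal.ofReal P.β * ENNReal.ofReal (‖θ - ℓ.opt Dr‖ ^ 2)
          ∂((vruIterLaw P ℓ Dr Df x (t + 1)).prod (stdGaussian (Model d))).map
            fun q => q.1 + σ • q.2 := by
        refine lintegral_mono fun θ => ?_
        rw [← ENNReal.ofReal_mul hβ.le]
        exact ENNReal.ofReal_le_ofReal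
          (hreg.risk_sub_opt_le_norm_sq hP.μ_pos hβ hP.L_pos hr θ)
    _ = ENNReal.ofReal P.β * ∫⁻ θ, ∫⁻ z, ENNReal.ofReal (‖(θ - ℓ.opt Dr) + σ • z‖ ^ 2)
          ∂stdGaussian (Model d) ∂vruIterLaw P ℓ Dr Df x (t + 1) := by
        rw [lintegral_const_mul _ hm, lintegral_map_prod hadd hm]
        simp_rw [add_sub_right_comm]
    _ = ENNReal.ofReal P.β * (∫⁻ θ, ENNReal.ofReal (‖θ - ℓ.opt Dr‖ ^ 2)
          ∂vruIterLaw P ℓ Dr Df x (t + 1) + ENNReal.ofReal (σ ^ 2 * d)) := by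
        have hσ : 0 ≤ σ ^ 2 * (d : ℝ) := by positivity
        simp_rw [lintegral_norm_add_smul_sq_stdGaussian, ENNReal.ofReal_add (sq_nonneg _) hσ]
        rw [lintegral_add_right _ measurable_const, lintegral_const, measure_univ, mul_one]
    _ ≤ _ := by
        rw [ENNReal.ofReal_mul hβ.le, ENNReal.ofReal_add (by positivity) (by positivity)]
        refine mul_le_mul_right (add_le_add_left ?_ _) _
        exact_mod_cast hiter

end VRU

/-! ### Noise and Fine-Tune -/

section NFT

variable {P : Params} {ℓ : Loss d s} {Dr : Measure (Data s)}

lemma Loss.IsRegular.dom_nonempty {μ β L : ℝ} (h : ℓ.IsRegular μ β L) : ℓ.dom.Nonempty :=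
  h.dom_interior.mono interior_subset

lemma Loss.IsRegular.measurable_proj {μ β L : ℝ} (h : ℓ.IsRegular μ β L) :
    Measurable (proj ℓ.dom) :=
  (lipschitzWith_proj h.dom_closed h.dom_convex h.dom_nonempty).continuous.measurable

lemma Loss.IsRegular.proj_mem {μ β L : ℝ} (h : ℓ.IsRegular μ β L) (x : Model d) :
    proj ℓ.dom x ∈ ℓ.dom := (proj_spec h.dom_closed h.dom_convex h.dom_nonempty x).1

lemma measurable_nftInit (hℓ : ℓ.IsRegular P.μ P.β P.L) (θstar : Model d) :
    Measurable fun z => proj ℓ.dom (θstar + (P.privacyBudget * P.ratio * (P.L / P.μ)) • z) :=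
  hℓ.measurable_proj.comp (by fun_prop)

lemma measurable_nftStep (hℓ : ℓ.IsRegular P.μ P.β P.L) (η : ℝ) :
    Measurable fun q : (Model d × Model d) × Data s =>
      (proj ℓ.dom (q.1.1 - η • ℓ.grad q.1.1 q.2), q.1.2 + q.1.1) := by
  have h1 : Measurable fun q : (Model d × Model d) × Data s => ℓ.grad q.1.1 q.2 :=
    hℓ.measurable_grad_uncurry.comp ((measurable_fst.comp measurable_fst).prodMk measurable_snd)
  exact (hℓ.measurable_proj.comp ((measurable_fst.comp measurable_fst).sub
    (h1.const_smul η))).prodMk (by fun_prop)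

lemma isProbabilityMeasure_nftInitLaw (hℓ : ℓ.IsRegular P.μ P.β P.L) (θstar : Model d) :
    IsProbabilityMeasure (nftInitLaw P ℓ θstar) :=
  Measure.isProbabilityMeasure_map (measurable_nftInit hℓ θstar).aemeasurable

lemma isProbabilityMeasure_nftIterLaw [IsProbabilityMeasure Dr] (hℓ : ℓ.IsRegular P.μ P.β P.L) (θstar : Model d) (η : ℝ)
    (t : ℕ) : IsProbabilityMeasure (nftIterLaw P ℓ Dr θstar η t) := by
  induction t with
  | zero =>
    have := isProbabilityMeasure_nftInitLaw hℓ θstar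
    exact Measure.isProbabilityMeasure_map (by fun_prop)
  | succ t ih => exact Measure.isProbabilityMeasure_map (measurable_nftStep hℓ η).aemeasurable

/-- The iterates stay in the domain, and the sum of the iterates starts at `0`. -/
lemma ae_nftIterLaw (hℓ : ℓ.IsRegular P.μ P.β P.L) (θstar : Model d) (η : ℝ) (t : ℕ) :
    ∀ᵐ q ∂nftIterLaw P ℓ Dr θstar η t, q.1 ∈ ℓ.dom ∧ (t = 0 → q.2 = 0) := by
  have hdom : MeasurableSet {q : Model d × Model d | q.1 ∈ ℓ.dom} :=
    measurable_fst hℓ.dom_closed.measurableSet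
  cases t with
  | zero =>
    have hset : MeasurableSet {q : Model d × Model d | q.1 ∈ ℓ.dom ∧ (0 = 0 → q.2 = 0)} := by
      simp only [forall_const]
      exact hdom.inter (measurable_snd (measurableSet_singleton 0))
    refine (ae_map_iff (by fun_prop) hset).2 ?_
    simp only [forall_const, and_true]
    exact (ae_map_iff (measurable_nftInit hℓ θstar).aemeasurable
      hℓ.dom_closed.measurableSet).2 (ae_of_all _ fun z => hℓ.proj_mem _)
  | succ t =>
    have : ∀ᵐ q ∂nftIterLaw P ℓ Dr θstar η (t + 1), q.1 ∈ ℓ.dom :=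
      (ae_map_iff (measurable_nftStep hℓ η).aemeasurable hdom).2
        (ae_of_all _ fun q => hℓ.proj_mem _)
    exact this.mono fun q hq => ⟨hq, fun h => absurd h t.succ_ne_zero⟩

variable [IsProbabilityMeasure Dr]

/-- The squared distance to the retain optimum plus `2 η t` times the excess risk of the running
average: a potential which grows by at most `η² L²` in expectation along projected stochastic
gradient descent. -/
noncomputable def nftPotential (ℓ : Loss d s) (Dr : Measure (Data s)) (η : ℝ) (t : ℕ)
    (q : Model d × Model d) : ℝ :=
  ‖q.1 - ℓ.opt Dr‖ ^ 2 + 2 * η * (t * (ℓ.risk Dr ((t : ℝ)⁻¹ • q.2) - ℓ.risk Dr (ℓ.opt Dr)))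

lemma measurable_nftPotential (hP : P.Valid) (hℓ : ℓ.IsRegular P.μ P.β P.L)
    (hr : ∀ θ, Integrable (ℓ.toFun θ) Dr) (η : ℝ) (t : ℕ) :
    Measurable fun q => ENNReal.ofReal (nftPotential ℓ Dr η t q) := by
  have hF : Measurable (ℓ.risk Dr) := (hℓ.continuous_risk hP.μ_pos hP.L_pos hr).measurable
  have hF' : Measurable fun q : Model d × Model d => ℓ.risk Dr ((t : ℝ)⁻¹ • q.2) :=
    hF.comp (by fun_prop)
  unfold nftPotential
  fun_prop

/-- Convexity of the risk along the running average. -/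
lemma mul_excess_average_le (hP : P.Valid) (hℓ : ℓ.IsRegular P.μ P.β P.L)
    (hr : ∀ θ, Integrable (ℓ.toFun θ) Dr) (t : ℕ) {θ S : Model d} (hS : t = 0 → S = 0) :
    ((t + 1 : ℕ) : ℝ) * (ℓ.risk Dr (((t + 1 : ℕ) : ℝ)⁻¹ • (S + θ)) - ℓ.risk Dr (ℓ.opt Dr))
      ≤ t * (ℓ.risk Dr ((t : ℝ)⁻¹ • S) - ℓ.risk Dr (ℓ.opt Dr))
        + (ℓ.risk Dr θ - ℓ.risk Dr (ℓ.opt Dr)) := by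
  rcases Nat.eq_zero_or_pos t with rfl | ht
  -- For `t = 0` the running average is the junk value `0⁻¹ • S`, with weight `0`.
  · simp [hS rfl]
  have ht' : (0 : ℝ) < t := Nat.cast_pos.2 ht
  have ha : 0 ≤ (t : ℝ) / ((t : ℝ) + 1) := by positivity
  have hb : 0 ≤ 1 / ((t : ℝ) + 1) := by positivity
  have h1 := (hℓ.convexOn_risk hP.μ_pos hP.L_pos hr).2 (Set.mem_univ ((t : ℝ)⁻¹ • S))
    (Set.mem_univ θ) ha hb (by field_simp)
  have e : (t / ((t : ℝ) + 1)) • (t : ℝ)⁻¹ • S + (1 / ((t : ℝ) + 1)) • θ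
      = ((t : ℝ) + 1)⁻¹ • (S + θ) := by
    rw [smul_smul, smul_add]
    congr 2 <;> field_simp
  rw [e, smul_eq_mul, smul_eq_mul] at h1
  push_cast
  have h2 := mul_le_mul_of_nonneg_left h1 (by positivity : (0 : ℝ) ≤ t + 1)
  have e2 : ((t : ℝ) + 1) * (t / ((t : ℝ) + 1) * ℓ.risk Dr ((t : ℝ)⁻¹ • S)
      + 1 / ((t : ℝ) + 1) * ℓ.risk Dr θ) = t * ℓ.risk Dr ((t : ℝ)⁻¹ • S) + ℓ.risk Dr θ := by
    field_simp
  rw [e2] at h2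
  linarith

lemma lintegral_nftPotential_succ_le (hP : P.Valid) (hℓ : ℓ.IsRegular P.μ P.β P.L)
    (hr : ∀ θ, Integrable (ℓ.toFun θ) Dr) (hopt : ℓ.opt Dr ∈ ℓ.dom) (θstar : Model d) {η : ℝ}
    (hη : 0 ≤ η) (t : ℕ) :
    ∫⁻ q, ENNReal.ofReal (nftPotential ℓ Dr η (t + 1) q) ∂nftIterLaw P ℓ Dr θstar η (t + 1)
      ≤ ∫⁻ q, ENNReal.ofReal (nftPotential ℓ Dr η t q) ∂nftIterLaw P ℓ Dr θstar η t
        + ENNReal.ofReal (η ^ 2 * P.L ^ 2) := by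
  have := isProbabilityMeasure_nftIterLaw (Dr := Dr) hℓ θstar η t
  have hm := measurable_nftPotential hP hℓ hr η (t + 1)
  have hex := excess_nonneg hP hℓ hr
  calc _ = ∫⁻ q, ∫⁻ ξ, ENNReal.ofReal (nftPotential ℓ Dr η (t + 1)
          (proj ℓ.dom (q.1 - η • ℓ.grad q.1 ξ), q.2 + q.1)) ∂Dr ∂nftIterLaw P ℓ Dr θstar η t := by
        rw [nftIterLaw, lintegral_map_prod (measurable_nftStep hℓ η) hm]
    _ ≤ ∫⁻ q, (ENNReal.ofReal (nftPotential ℓ Dr η t q) + ENNReal.ofReal (η ^ 2 * P.L ^ 2))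
          ∂nftIterLaw P ℓ Dr θstar η t := by
        refine lintegral_mono_ae ?_
        filter_upwards [ae_nftIterLaw (Dr := Dr) hℓ θstar η t] with q hq
        have h0 : 0 ≤ 2 * η * (((t + 1 : ℕ) : ℝ)
            * (ℓ.risk Dr (((t + 1 : ℕ) : ℝ)⁻¹ • (q.2 + q.1)) - ℓ.risk Dr (ℓ.opt Dr))) :=
          mul_nonneg (by positivity) (mul_nonneg (Nat.cast_nonneg _) (hex _))
        refine (lintegral_norm_proj_step_sq_le hℓ.dom_closed hℓ.dom_convex
          (hℓ.integrable_grad hP.L_pos Dr q.1) (hℓ.norm_grad_le hP.L_pos hq.1) q.1 hopt η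
          h0).trans ?_
        refine le_trans (ENNReal.ofReal_le_ofReal ?_) ENNReal.ofReal_add_le
        have h1 := mul_le_mul_of_nonneg_left (mul_excess_average_le hP hℓ hr t hq.2 (θ := q.1))
          (by positivity : 0 ≤ 2 * η)
        have h2 := mul_le_mul_of_nonneg_left
          (hℓ.risk_sub_opt_le_inner hP.μ_pos hP.L_pos hr q.1) (by positivity : 0 ≤ 2 * η)
        simp only [Loss.riskGrad] at h2
        unfold nftPotential
        linarith
    _ = _ := by
        rw [lintegral_add_right _ measurable_const, lintegral_const, measure_univ, mul_one]

variable {Df : Measure (Data s)} [IsProbabilityMeasure Df]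

/-- The Gaussian start is at mean squared distance at most `(1 + d κ²) (ρ L / μ)²` from the retain
optimum, since projecting onto the domain does not increase the distance. -/
lemma lintegral_nftPotential_zero_le (hP : P.Valid) (hℓ : ℓ ∈ lossClass P d Dr Df) (η : ℝ) :
    ∫⁻ q, ENNReal.ofReal (nftPotential ℓ Dr η 0 q)
        ∂nftIterLaw P ℓ Dr (ℓ.opt (trainDist P.rf Dr Df)) η 0
      ≤ ENNReal.ofReal ((P.ratio * (P.L / P.μ)) ^ 2 * (1 + d * P.privacyBudget ^ 2)) := by
  obtain ⟨hreg, hr, hf, hstar, hopt⟩ := hℓ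
  have hdist := hreg.norm_opt_train_sub_opt_retain_le hP.μ_pos hP.β_pos hP.L_pos hP.rf_pos
    hP.rf_lt_one hr hf hstar
  set x := ℓ.opt (trainDist P.rf Dr Df)
  have hpair : Measurable fun θ : Model d => (θ, (0 : Model d)) := by fun_prop
  have hm := measurable_nftPotential hP hreg hr η 0
  rw [nftIterLaw, lintegral_map hm hpair, nftInitLaw,
    lintegral_map (f := fun θ => ENNReal.ofReal (nftPotential ℓ Dr η 0 (θ, 0)))
      (hm.comp hpair) (measurable_nftInit hreg x)]
  simp only [nftPotential, Nat.cast_zero, zero_mul, mul_zero, add_zero]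
  set σ := P.privacyBudget * P.ratio * (P.L / P.μ) with hσ
  calc _ ≤ ∫⁻ z, ENNReal.ofReal (‖(x - ℓ.opt Dr) + σ • z‖ ^ 2) ∂stdGaussian (Model d) := by
        refine lintegral_mono fun z => ENNReal.ofReal_le_ofReal ?_
        rw [← add_sub_right_comm]
        exact pow_le_pow_left₀ (norm_nonneg _)
          (norm_proj_sub_le hreg.dom_closed hreg.dom_convex _ hopt) 2
    _ = ENNReal.ofReal (‖x - ℓ.opt Dr‖ ^ 2 + σ ^ 2 * d) :=
        lintegral_norm_add_smul_sq_stdGaussian _ _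
    _ ≤ _ := by
        refine ENNReal.ofReal_le_ofReal ?_
        have h1 := pow_le_pow_left₀ (norm_nonneg _) hdist 2
        change ‖x - ℓ.opt Dr‖ ^ 2 ≤ (P.ratio * (P.L / P.μ)) ^ 2 at h1
        rw [hσ]
        linarith

lemma lintegral_nftPotential_le (hP : P.Valid) (hℓ : ℓ ∈ lossClass P d Dr Df) {η : ℝ}
    (hη : 0 ≤ η) (t : ℕ) :
    ∫⁻ q, ENNReal.ofReal (nftPotential ℓ Dr η t q)
        ∂nftIterLaw P ℓ Dr (ℓ.opt (trainDist P.rf Dr Df)) η t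
      ≤ ENNReal.ofReal ((P.ratio * (P.L / P.μ)) ^ 2 * (1 + d * P.privacyBudget ^ 2)
          + t * (η ^ 2 * P.L ^ 2)) := by
  induction t with
  | zero => simpa using lintegral_nftPotential_zero_le hP hℓ η
  | succ t ih =>
    refine (lintegral_nftPotential_succ_le hP hℓ.1 hℓ.2.1 hℓ.2.2.2.2 _ hη t).trans ?_
    refine (add_le_add_left ih _).trans ?_
    rw [← ENNReal.ofReal_add (by positivity) (by positivity)]
    refine ENNReal.ofReal_le_ofReal (le_of_eq ?_)
    push_cast
    ring

lemma expectedExcess_NFT_le (hP : P.Valid) (hℓ : ℓ ∈ lossClass P d Dr Df) {T : ℕ} (hT : 1 ≤ T) :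
    expectedExcess ℓ Dr (NFT P T ℓ Dr Df)
      ≤ ENNReal.ofReal (P.ratio * √(1 + d * P.privacyBudget ^ 2) * P.e₀ / √(T : ℝ)) := by
  have hreg := hℓ.1
  have hr := hℓ.2.1
  have hT' : (0 : ℝ) < T := by exact_mod_cast hT
  have hμ := hP.μ_pos
  have hL := hP.L_pos
  have hρ := hP.ratio_pos
  set a : ℝ := √(1 + d * P.privacyBudget ^ 2) with ha
  have ha0 : 0 < a := Real.sqrt_pos.2 (by positivity)
  have ha2 : a ^ 2 = 1 + d * P.privacyBudget ^ 2 := Real.sq_sqrt (by positivity)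
  set w : ℝ := √(T : ℝ) with hw
  have hw0 : 0 < w := Real.sqrt_pos.2 hT'
  have hw2 : w ^ 2 = T := Real.sq_sqrt hT'.le
  set η : ℝ := nftStepSize P d T with hη
  have hη' : η = P.ratio * a / (P.μ * w) := rfl
  have hη0 : 0 < η := by rw [hη']; positivity
  have hpot := lintegral_nftPotential_le hP hℓ hη0.le T
  have hF : Measurable (ℓ.risk Dr) := (hreg.continuous_risk hμ hL hr).measurable
  have hm : Measurable fun θ : Model d =>
      ENNReal.ofReal (ℓ.risk Dr θ - ℓ.risk Dr (ℓ.opt Dr)) := by fun_prop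
  have hc : 0 ≤ (2 * η * T)⁻¹ := by positivity
  rw [NFT, expectedExcess, lintegral_map hm (by fun_prop), ← hη]
  calc _ ≤ ∫⁻ q, ENNReal.ofReal (2 * η * T)⁻¹ * ENNReal.ofReal (nftPotential ℓ Dr η T q)
          ∂nftIterLaw P ℓ Dr (ℓ.opt (trainDist P.rf Dr Df)) η T := by
        refine lintegral_mono fun q => ?_
        rw [← ENNReal.ofReal_mul hc]
        refine ENNReal.ofReal_le_ofReal ?_
        rw [← div_eq_inv_mul, le_div_iff₀ (by positivity), nftPotential]
        have := sq_nonneg ‖q.1 - ℓ.opt Dr‖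
        linarith
    _ ≤ ENNReal.ofReal (2 * η * T)⁻¹ * ENNReal.ofReal ((P.ratio * (P.L / P.μ)) ^ 2
          * (1 + d * P.privacyBudget ^ 2) + T * (η ^ 2 * P.L ^ 2)) := by
        rw [lintegral_const_mul _ (measurable_nftPotential hP hreg hr η T)]
        exact mul_le_mul_right hpot _
    _ = _ := by
        rw [← ENNReal.ofReal_mul hc]
        congr 1
        rw [hη', Params.e₀, ← ha2, ← hw2]
        field_simp
        ring

end NFT

/-! ### Convergence times -/

lemma convTime_le_of_forall {P : Params} {U : Algorithm d s} {e : ℝ} {Dr Df : Measure (Data s)}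
    {T : ℕ} (hT : 2 ≤ T) {b : ℝ} (hTb : (T : ℝ) ≤ b)
    (h : ∀ ℓ ∈ lossClass P d Dr Df, expectedExcess ℓ Dr (U T ℓ Dr Df) ≤ ENNReal.ofReal e) :
    convTime P U e Dr Df ≤ ENNReal.ofReal b := by
  refine iSup₂_le fun ℓ hℓ => (iInf₂_le T ⟨hT, h ℓ hℓ⟩).trans ?_
  rw [← ENNReal.ofReal_natCast]
  exact ENNReal.ofReal_le_ofReal hTb

/-- The inequality `8 B M (1 + log T) ≤ T` has a solution of order `(1 + M) log (3 + M)`. -/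
lemma exists_mul_one_add_log_le {B M : ℝ} (hB : 1 ≤ B) (hM : 0 ≤ M) :
    ∃ T : ℕ, 2 ≤ T ∧ 8 * B * M * (1 + Real.log T) ≤ T
      ∧ (T : ℝ) ≤ 1600 * B ^ 2 * ((1 + M) * Real.log (3 + M)) := by
  set lam := Real.log (3 + M) with hlam
  have hlam1 : 1 ≤ lam := by
    rw [hlam, Real.le_log_iff_exp_le (by linarith)]
    linarith [Real.exp_one_lt_three]
  have hB2 : 1 ≤ B ^ 2 := one_le_pow₀ hB
  have hX1 : 1 ≤ (1 + M) * lam := one_le_mul_of_one_le_of_one_le (by linarith) hlam1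
  set X := (1 + M) * lam with hX
  have hBX : 1 ≤ B ^ 2 * X := one_le_mul_of_one_le_of_one_le hB2 hX1
  -- The factor `800 B² = 8 B * 100 B` is what the bound `1 + log T ≤ 100 B lam` below requires;
  -- that bound in turn uses `log (1600 B²) = 2 log (40 B) ≤ 80 B - 2`.
  set T := ⌈800 * B ^ 2 * X⌉₊ with hT
  have hT1 : 800 * B ^ 2 * X ≤ T := Nat.le_ceil _
  have hT2 : (T : ℝ) ≤ 1600 * B ^ 2 * X := by
    have : (T : ℝ) < 800 * B ^ 2 * X + 1 := Nat.ceil_lt_add_one (by linarith)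
    linarith
  have h2 : (2 : ℝ) ≤ T := by linarith
  refine ⟨T, by exact_mod_cast h2, ?_, hT2⟩
  have hlog : Real.log T ≤ 80 * B - 2 + 2 * lam := by
    have e : 1600 * B ^ 2 * X = (40 * B) ^ 2 * ((1 + M) * lam) := by rw [hX]; ring
    calc Real.log T ≤ Real.log (1600 * B ^ 2 * X) := Real.log_le_log (by linarith) hT2
      _ = 2 * Real.log (40 * B) + (Real.log (1 + M) + Real.log lam) := by
          rw [e, Real.log_mul (by positivity) (by positivity), Real.log_mul (by positivity)
            (by positivity), Real.log_pow]
          norm_num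
      _ ≤ _ := by
          have l1 := Real.log_le_sub_one_of_pos (show 0 < 40 * B by linarith)
          have l2 : Real.log (1 + M) ≤ lam := Real.log_le_log (by linarith) (by linarith)
          have l3 := Real.log_le_sub_one_of_pos (show 0 < lam by linarith)
          linarith
  have h3 : 1 + Real.log T ≤ 100 * B * lam := by nlinarith
  calc 8 * B * M * (1 + Real.log T) ≤ 8 * B * M * (100 * B * lam) :=
        mul_le_mul_of_nonneg_left h3 (by positivity)
    _ = 800 * B ^ 2 * (M * lam) := by ring
    _ ≤ 800 * B ^ 2 * X := by
        refine mul_le_mul_of_nonneg_left ?_ (by positivity)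
        rw [hX]; nlinarith
    _ ≤ T := hT1

namespace Params.Valid

variable {P : Params}

lemma log_inv_pos (hP : P.Valid) : 0 < Real.log (1 / P.δ) :=
  Real.log_pos ((one_lt_div hP.δ_pos).2 hP.δ_lt_one)

lemma log_inv_le (hP : P.Valid) {δ₀ : ℝ} (hδ : P.δ ≤ δ₀) :
    Real.log (1 / δ₀) ≤ Real.log (1 / P.δ) :=
  Real.log_le_log (by have := hP.δ_pos; have := this.trans_le hδ; positivity)
    (one_div_le_one_div_of_le hP.δ_pos hδ)

lemma h_le (hP : P.Valid) {l₀ : ℝ} (hl₀ : 0 < l₀) (hl : l₀ ≤ Real.log (1 / P.δ)) {T : ℕ}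
    (hT : 2 ≤ T) :
    P.h T ≤ (625 / l₀ + 624) * Real.log (1 / P.δ) * (1 + Real.log T) := by
  have hT' : (2 : ℝ) ≤ T := by exact_mod_cast hT
  have hlogT : 0 < Real.log T := Real.log_pos (by linarith)
  have h1 := Real.log_le_sub_one_of_pos hlogT
  have h2 : Real.log (2 / P.δ) = Real.log 2 + Real.log (1 / P.δ) := by
    rw [← Real.log_mul (by norm_num) (one_div_ne_zero hP.δ_pos.ne'), mul_one_div]
  have h3 := Real.log_two_lt_d9
  have h4 : 1 ≤ Real.log (1 / P.δ) / l₀ := (one_le_div hl₀).2 hl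
  have e : (625 / l₀ + 624) * Real.log (1 / P.δ) * (1 + Real.log T)
      = 625 * (Real.log (1 / P.δ) / l₀ * (1 + Real.log T))
        + 624 * (Real.log (1 / P.δ) * (1 + Real.log T)) := by ring
  have h5 : 1 + Real.log T ≤ Real.log (1 / P.δ) / l₀ * (1 + Real.log T) :=
    le_mul_of_one_le_left (by linarith) h4
  have h6 : Real.log (1 / P.δ) ≤ Real.log (1 / P.δ) * (1 + Real.log T) :=
    le_mul_of_one_le_right hP.log_inv_pos.le (by linarith)
  rw [Params.h, e, h2]
  linarith

lemma TmaxVRU_pos (hP : P.Valid) (d : ℕ) {e : ℝ} (he : 0 < e) : 0 < TmaxVRU P d e := by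
  have := hP.one_le_condNumber
  have := hP.log_inv_pos
  have := hP.e₀_pos
  have := hP.ratio_pos
  rw [TmaxVRU]
  positivity

lemma TmaxNFT_pos (hP : P.Valid) (d : ℕ) {e : ℝ} (he : 0 < e) : 0 < TmaxNFT P d e := by
  have := hP.e₀_pos
  have := hP.ratio_pos
  rw [TmaxNFT]
  positivity

/-- The error bound of VRU in terms of `T_e^max(VRU)`. -/
lemma vru_bound_le (hP : P.Valid) {B : ℝ} (hB : 1 ≤ B) {T : ℕ} (hT : 2 ≤ T)
    (hh : P.h T ≤ B * Real.log (1 / P.δ) * (1 + Real.log T)) (d : ℕ) {e : ℝ} (he : 0 < e) :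
    P.β * ((P.ratio * P.L * (1 + P.condNumber)) ^ 2 / P.μ ^ 2 / T
          + (P.ratio * P.ν T * P.privacyBudget) ^ 2 * d)
      ≤ 8 * B * TmaxVRU P d e * (1 + Real.log T) / T * e := by
  have hT' : (2 : ℝ) ≤ T := by exact_mod_cast hT
  have hT0 : (0 : ℝ) < T := by linarith
  have hlogT : 0 < Real.log T := Real.log_pos (by linarith)
  have hl := hP.log_inv_pos
  have hμ := hP.μ_pos
  have hL := hP.L_pos
  have hρ := hP.ratio_pos
  have hκ := hP.one_le_condNumber
  set l := Real.log (1 / P.δ) with hldef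
  set κ := P.condNumber with hκdef
  set k := P.privacyBudget
  set ρ := P.ratio
  have hβ : P.β = κ * P.μ := by rw [hκdef, Params.condNumber]; field_simp
  -- Monotonicity of the square root spares a discussion of the sign of `h`.
  have hS : √(2 * P.h T) ^ 2 ≤ 2 * (B * l * (1 + Real.log T)) := by
    have h0 : 0 ≤ 2 * (B * l * (1 + Real.log T)) := by positivity
    calc √(2 * P.h T) ^ 2 ≤ √(2 * (B * l * (1 + Real.log T))) ^ 2 :=
          pow_le_pow_left₀ (Real.sqrt_nonneg _) (Real.sqrt_le_sqrt (by linarith)) 2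
      _ = _ := Real.sq_sqrt h0
  have hν : P.ν T ^ 2 = √(2 * P.h T) ^ 2 * P.L ^ 2 * (1 + κ) ^ 2 / (P.μ ^ 2 * T) := by
    rw [Params.ν, mul_pow, mul_pow, div_pow, mul_pow P.μ, Real.sq_sqrt hT0.le]
    ring
  have hsplit : P.β * ((ρ * P.L * (1 + κ)) ^ 2 / P.μ ^ 2 / T + (ρ * P.ν T * k) ^ 2 * d)
      = κ * ρ ^ 2 * P.L ^ 2 / (P.μ * T) * ((1 + κ) ^ 2 * (1 + √(2 * P.h T) ^ 2 * (k ^ 2 * d))) := by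
    rw [mul_pow (ρ * P.ν T), mul_pow ρ, hν, hβ]
    field_simp
  have h1 : (1 + κ) ^ 2 ≤ 4 * κ ^ 2 := by nlinarith
  have h2 : 1 + √(2 * P.h T) ^ 2 * (k ^ 2 * d)
      ≤ 2 * B * (1 + Real.log T) * (1 + d * k ^ 2 * l) := by
    have h3 := mul_le_mul_of_nonneg_right hS (by positivity : 0 ≤ k ^ 2 * (d : ℝ))
    have h4 : 1 ≤ B * (1 + Real.log T) := one_le_mul_of_one_le_of_one_le hB (by linarith)
    linarith
  rw [hsplit]
  calc _ ≤ κ * ρ ^ 2 * P.L ^ 2 / (P.μ * T)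
          * (4 * κ ^ 2 * (2 * B * (1 + Real.log T) * (1 + d * k ^ 2 * l))) := by
        refine mul_le_mul_of_nonneg_left ?_ (by positivity)
        exact mul_le_mul h1 h2 (by positivity) (by positivity)
    _ = _ := by
        rw [TmaxVRU, Params.e₀, ← hldef, ← hκdef]
        field_simp
        ring

end Params.Valid

lemma convTime_VRU_le {P : Params} (hP : P.Valid) {l₀ : ℝ} (hl₀ : 0 < l₀)
    (hl : l₀ ≤ Real.log (1 / P.δ)) (Dr Df : Measure (Data s)) [IsProbabilityMeasure Dr]
    [IsProbabilityMeasure Df] {e : ℝ} (he : 0 < e) :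
    convTime P (VRU P : Algorithm d s) e Dr Df
      ≤ ENNReal.ofReal (1600 * (625 / l₀ + 624) ^ 2
          * ((1 + TmaxVRU P d e) * Real.log (3 + TmaxVRU P d e))) := by
  have hB : 1 ≤ 625 / l₀ + 624 := by
    have : 0 < 625 / l₀ := by positivity
    linarith
  obtain ⟨T, hT2, hT, hTle⟩ := exists_mul_one_add_log_le hB (hP.TmaxVRU_pos d he).le
  refine convTime_le_of_forall hT2 hTle fun ℓ hℓ =>
    (expectedExcess_VRU_le hP hℓ (by omega)).trans (ENNReal.ofReal_le_ofReal ?_)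
  refine (hP.vru_bound_le hB hT2 (hP.h_le hl₀ hl hT2) d he).trans ?_
  have hT0 : (0 : ℝ) < T := by exact_mod_cast (by omega : 0 < T)
  exact mul_le_of_le_one_left he.le ((div_le_one hT0).2 hT)

lemma convTime_NFT_le {P : Params} (hP : P.Valid) (Dr Df : Measure (Data s))
    [IsProbabilityMeasure Dr] [IsProbabilityMeasure Df] {e : ℝ} (he : 0 < e) :
    convTime P (NFT P : Algorithm d s) e Dr Df ≤ ENNReal.ofReal (2 * (1 + TmaxNFT P d e)) := by
  have hM := hP.TmaxNFT_pos d he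
  have hceil := Nat.ceil_lt_add_one hM.le
  refine convTime_le_of_forall (T := max 2 ⌈TmaxNFT P d e⌉₊) (le_max_left _ _) ?_ fun ℓ hℓ =>
    (expectedExcess_NFT_le hP hℓ (le_trans (by norm_num) (le_max_left _ _))).trans
      (ENNReal.ofReal_le_ofReal ?_)
  · rw [Nat.cast_max]
    exact max_le (by push_cast; linarith) (by linarith)
  · set T := max 2 ⌈TmaxNFT P d e⌉₊
    have hT0 : (0 : ℝ) < T := by exact_mod_cast (lt_of_lt_of_le (by norm_num) (le_max_left 2 _))
    have hle : TmaxNFT P d e ≤ T :=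
      (Nat.le_ceil _).trans (by exact_mod_cast le_max_right 2 ⌈TmaxNFT P d e⌉₊)
    have hρ := hP.ratio_pos
    have he0 := hP.e₀_pos
    rw [div_le_iff₀ (Real.sqrt_pos.2 hT0), ← div_le_iff₀' he]
    refine Real.le_sqrt_of_sq_le (le_of_eq_of_le ?_ hle)
    rw [div_pow, mul_pow, mul_pow, Real.sq_sqrt (by positivity), TmaxNFT]
    ring

/-! ### Comparison of the two bounds -/

lemma TmaxVRU_div_TmaxNFT {P : Params} (hP : P.Valid) (d : ℕ) {e : ℝ} (he : 0 < e) :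
    TmaxVRU P d e / TmaxNFT P d e
      = (1 + d * P.privacyBudget ^ 2 * Real.log (1 / P.δ)) / (1 + d * P.privacyBudget ^ 2)
        * (P.condNumber ^ 3 * (e / P.e₀)) := by
  have h1 := hP.e₀_pos
  have h2 := hP.ratio_pos
  have h3 : 0 < 1 + d * P.privacyBudget ^ 2 := by positivity
  rw [TmaxVRU, TmaxNFT]
  field_simp

/-- The privacy budget is bounded below for a bounded privacy level `ε`. -/
lemma Params.Valid.le_privacyBudget_sq {P : Params} (hP : P.Valid) {ε₀ : ℝ} (hε : P.ε ≤ ε₀) :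
    ε₀⁻¹ ^ 2 * (2 * Real.log 2.5) ≤ P.privacyBudget ^ 2 := by
  have h25 : (0 : ℝ) < Real.log 2.5 := Real.log_pos (by norm_num)
  have h1 : Real.log 2.5 ≤ Real.log (2.5 / P.δ) :=
    Real.log_le_log (by norm_num) (le_div_self (by norm_num) hP.δ_pos hP.δ_lt_one.le)
  have h0 : 0 < ε₀ := hP.ε_pos.trans_le hε
  have h2 : ε₀⁻¹ ^ 2 ≤ P.ε⁻¹ ^ 2 :=
    pow_le_pow_left₀ (by positivity) (inv_anti₀ hP.ε_pos hε) 2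
  rw [Params.privacyBudget, mul_pow, Real.sq_sqrt (by linarith)]
  exact mul_le_mul h2 (by linarith) (by linarith) (by positivity)

/-- For `a` bounded away from `0` and `l` bounded away from `0`, `(1 + a l) / (1 + a)` is of the
exact order `l`. -/
lemma one_add_mul_div_bounds {a a₀ l l₀ : ℝ} (ha₀ : 0 < a₀) (ha : a₀ ≤ a) (hl₀ : 0 < l₀)
    (hl : l₀ ≤ l) :
    a₀ / (1 + a₀) * l ≤ (1 + a * l) / (1 + a) ∧ (1 + a * l) / (1 + a) ≤ (1 / l₀ + 1) * l := by
  have hapos : 0 < 1 + a := by linarith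
  have hlpos : 0 < l := by linarith
  constructor
  · rw [le_div_iff₀ hapos, div_mul_eq_mul_div, div_mul_eq_mul_div, div_le_iff₀ (by linarith)]
    nlinarith [mul_le_mul_of_nonneg_right ha hlpos.le]
  · rw [div_le_iff₀ hapos]
    have h1 : 1 ≤ 1 / l₀ * l := by rw [one_div_mul_eq_div]; exact (one_le_div hl₀).2 hl
    have h2 : 0 ≤ 1 / l₀ * l * a := by have := ha₀.trans_le ha; positivity
    nlinarith

lemma TmaxVRU_isTheta {P : Params} (hP : P.Valid) (d : ℕ) :
    TmaxVRU P d =Θ[𝓝[>] 0] fun e : ℝ => 1 / e := by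
  have e : TmaxVRU P d = fun e => TmaxVRU P d 1 * (1 / e) := by
    funext e
    simp only [TmaxVRU]
    ring
  rw [e]
  exact (isTheta_const_mul_left (hP.TmaxVRU_pos d one_pos).ne').2 (isTheta_refl _ _)

lemma TmaxNFT_isTheta {P : Params} (hP : P.Valid) (d : ℕ) :
    TmaxNFT P d =Θ[𝓝[>] 0] fun e : ℝ => 1 / e ^ 2 := by
  have e : TmaxNFT P d = fun e => TmaxNFT P d 1 * (1 / e ^ 2) := by
    funext e
    simp only [TmaxNFT]
    ring
  rw [e]
  exact (isTheta_const_mul_left (hP.TmaxNFT_pos d one_pos).ne').2 (isTheta_refl _ _)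

lemma tendsto_TmaxVRU_div_TmaxNFT {P : Params} (hP : P.Valid) (d : ℕ) :
    Tendsto (fun e => TmaxVRU P d e / TmaxNFT P d e) (𝓝[>] 0) (𝓝 0) := by
  set A := (1 + d * P.privacyBudget ^ 2 * Real.log (1 / P.δ)) / (1 + d * P.privacyBudget ^ 2)
  have h : Tendsto (fun e : ℝ => A * (P.condNumber ^ 3 * (e / P.e₀))) (𝓝[>] 0) (𝓝 0) := by
    have hc : Continuous fun e : ℝ => A * (P.condNumber ^ 3 * (e / P.e₀)) := by fun_prop
    simpa using (hc.tendsto 0).mono_left nhdsWithin_le_nhds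
  refine h.congr' ?_
  filter_upwards [self_mem_nhdsWithin] with e he
  exact (TmaxVRU_div_TmaxNFT hP d he).symm

end Unlearning

theorem mainTheorem2 (ε₀ δ₀ : ℝ) (hε₀ : 0 < ε₀) (hδ₀ : 0 < δ₀) (hδ₁ : δ₀ < 1) :
    ∃ c C : ℝ, 0 < c ∧ 0 < C ∧
      ∀ (d s : ℕ) (P : Unlearning.Params), 1 ≤ d → P.Valid → P.ε ≤ ε₀ → P.δ ≤ δ₀ →
        -- the two expressions are asymptotic upper bounds on the convergence times
        (∀ (Dr Df : Measure (Unlearning.Data s)) [IsProbabilityMeasure Dr]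
            [IsProbabilityMeasure Df] (e : ℝ), 0 < e →
          Unlearning.convTime P (Unlearning.VRU P : Unlearning.Algorithm d s) e Dr Df
              ≤ ENNReal.ofReal (C * (1 + Unlearning.TmaxVRU P d e)
                  * Real.log (3 + Unlearning.TmaxVRU P d e)) ∧
          Unlearning.convTime P (Unlearning.NFT P : Unlearning.Algorithm d s) e Dr Df
              ≤ ENNReal.ofReal (C * (1 + Unlearning.TmaxNFT P d e))) ∧
        -- their ratio is of the exact order `κ_ℓ³ log (1 / δ) e / e₀`
        (∀ e : ℝ, 0 < e →
          c * (P.condNumber ^ 3 * Real.log (1 / P.δ) * (e / P.e₀))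
              ≤ Unlearning.TmaxVRU P d e / Unlearning.TmaxNFT P d e ∧
          Unlearning.TmaxVRU P d e / Unlearning.TmaxNFT P d e
              ≤ C * (P.condNumber ^ 3 * Real.log (1 / P.δ) * (e / P.e₀))) ∧
        -- orders `1 / e` and `1 / e²`, and the comparison in the low-error regime
        (Unlearning.TmaxVRU P d =Θ[𝓝[>] 0] fun e : ℝ => 1 / e) ∧
        (Unlearning.TmaxNFT P d =Θ[𝓝[>] 0] fun e : ℝ => 1 / e ^ 2) ∧
        Tendsto (fun e => Unlearning.TmaxVRU P d e / Unlearning.TmaxNFT P d e)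
          (𝓝[>] 0) (𝓝 0) := by
  set l₀ := Real.log (1 / δ₀)
  have hl₀ : 0 < l₀ := Real.log_pos ((one_lt_div hδ₀).2 hδ₁)
  set a₀ := ε₀⁻¹ ^ 2 * (2 * Real.log 2.5)
  have ha₀ : 0 < a₀ := by
    have h25 : (0 : ℝ) < Real.log 2.5 := Real.log_pos (by norm_num)
    positivity
  set C₁ := 1600 * (625 / l₀ + 624) ^ 2
  have hC₁ : 0 < C₁ := by positivity
  have hl₀' : 0 < 1 / l₀ := by positivity
  refine ⟨a₀ / (1 + a₀), C₁ + 2 + (1 / l₀ + 1), by positivity, by positivity, ?_⟩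
  intro d s P hd hP hε hδ
  have hl : l₀ ≤ Real.log (1 / P.δ) := hP.log_inv_le hδ
  refine ⟨fun Dr Df _ _ e he => ⟨?_, ?_⟩, fun e he => ?_, Unlearning.TmaxVRU_isTheta hP d,
    Unlearning.TmaxNFT_isTheta hP d, Unlearning.tendsto_TmaxVRU_div_TmaxNFT hP d⟩
  · refine (Unlearning.convTime_VRU_le hP hl₀ hl Dr Df he).trans (ENNReal.ofReal_le_ofReal ?_)
    have hM := hP.TmaxVRU_pos d he
    have hlog : 0 < Real.log (3 + Unlearning.TmaxVRU P d e) := Real.log_pos (by linarith)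
    rw [← mul_assoc]
    gcongr
    linarith
  · refine (Unlearning.convTime_NFT_le hP Dr Df he).trans (ENNReal.ofReal_le_ofReal ?_)
    have hM := hP.TmaxNFT_pos d he
    gcongr
    linarith
  · have hκ := hP.one_le_condNumber
    have he₀ := hP.e₀_pos
    have hw : 0 ≤ P.condNumber ^ 3 * (e / P.e₀) := by positivity
    have ha : a₀ ≤ d * P.privacyBudget ^ 2 :=
      (hP.le_privacyBudget_sq hε).trans
        (le_mul_of_one_le_left (sq_nonneg _) (by exact_mod_cast hd))
    obtain ⟨h1, h2⟩ := Unlearning.one_add_mul_div_bounds ha₀ ha hl₀ hl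
    have h3 := mul_le_mul_of_nonneg_right h1 hw
    have h4 := mul_le_mul_of_nonneg_right h2 hw
    have h5 : 0 ≤ (C₁ + 2) * (Real.log (1 / P.δ) * (P.condNumber ^ 3 * (e / P.e₀))) :=
      mul_nonneg (by positivity) (mul_nonneg hP.log_inv_pos.le hw)
    rw [Unlearning.TmaxVRU_div_TmaxNFT hP d he]
    constructor <;> linarith
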